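/- Let $N\ge 1$. A chain is a tuple $c=(c_0,\dots,c_{N+1})\in(\mathbb R^2)^{N+2}$. Its rays are $R_0=(c_0,c_1]$, the half-line ending at $c_1$ and passing through $c_0$ (empty if $c_0=c_1$), and the segments $R_j=[c_j,c_{j+1}]$ for $1\le j\le N$. Let $\mathrm{LO}^N(\mathbb R^2)\subset(\mathbb R^2)^{N+2}$ be the space of chains such that every $R_j$ is non-empty, $c_k\notin R_j$ for all $0\le j\le N$ and $1\le k\le N+1$ with $k\ne j,j+1$, and $c_i\notin[c_{i-1},c_{i+1}]$ for $1\le i\le N$. A primary beam is a pair of chains $F=((a_i),(b_i))$ with $a_k\neq b_k$ for $1\le k\le N$, $a_0=b_0=(-1,0)$, $a_{N+1}=b_{N+1}$ and $\frac{a_1+b_1}{2}=(0,0)$. Put $S_k=[a_k,b_k]$ for $1\le k\le N+1$. For $t\in[0,1]$, the $t$-chain $P^t=(P^t_i)_{0\le i\le N+1}$ of $F$ is defined by $P^t_1=(1-t)a_1+tb_1$, $P^t_0=P^t_1+a_0$ and, recursively for $2\le i\le N+1$ with $P^t_{i-1}=(1-\lambda_{i-1})a_{i-1}+\lambda_{i-1}b_{i-1}$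 (where $\lambda_1=t$): if the lines $(a_{i-1}a_i)$ and $(b_{i-1}b_i)$ meet at a point $I$, then $P^t_i$ is the intersection of the line $(P^t_{i-1}I)$ with $S_i$; otherwise $P^t_i=(1-\lambda_{i-1})a_i+\lambda_{i-1}b_i$. (This is well defined when the reflexion condition below holds.) Write $R^t_j$ for the rays of $P^t$. A beam is a primary beam such that * (reflexion) for $1\le i\le N$ the four points $a_{i-1},b_{i-1},a_{i+1},b_{i+1}$ lie strictly on the same side of the line $(a_ib_i)$; * (non-obscuration) $R^t_j\cap S_k=\varnothing$ for all $t\in[0,1]$, $0\le j\le N$ and $1\le k\le N+1$ with $k\ne j,j+1$. Let $\mathrm{Faisc}^N(\mathbb R^2)\subset(\mathbb R^2)^{2(N+2)}$ be the space of beams. All spaces carry the induced topology and $\pi_0$ denotes the set of connected components. For a beam $F$ the centered chain $M(F)=P^{1/2}=(c_i)$ lies in $\mathrm{LO}^N(\mathbb R^2)$. Its nomenclature $\mathrm N^F(F)\in\pi_0(\mathrm{LO}^N(\mathbb R^2))$ is the component of $\mathrm{LO}^N(\mathbb R^2)$ containing $M(F)$. Let $A(x)\in\mathbb R/2\pi\mathbb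 Z$ be the angle of a nonzero vector $x$, and $\theta_j=A(a_j-b_j)$ for $1\le j\le N$. The characteristic $\mathrm{Car}^F(F)\in\{-1,1\}^N$ has $j$-th entry $1$ if $$\theta_j\in\bigl(A(c_j-c_{j-1})+(-1)^j\,]0,\pi[\bigr)\cap\bigl(A(c_j-c_{j+1})+(-1)^j\,]0,\pi[\bigr),$$ and $-1$ if $\theta_j$ lies in the analogous set with $(-1)^{j+1}$ in place of $(-1)^j$; exactly one of the two holds. **Theorem.** For every $N\ge 1$: 1. If $F,F'\in\mathrm{Faisc}^N(\mathbb R^2)$ satisfy $\mathrm N^F(F)=\mathrm N^F(F')$ and $\mathrm{Car}^F(F)=\mathrm{Car}^F(F')$, then there is a continuous path from $F$ to $F'$ in $\mathrm{Faisc}^N(\mathbb R^2)$. 2. Two beams are joined by a continuous path in $\mathrm{Faisc}^N(\mathbb R^2)$ if and only if they lie in the same connected component of $\mathrm{Faisc}^N(\mathbb R^2)$. 3. The map $\mathrm I^F:F\mapsto(\mathrm N^F(F),\mathrm{Car}^F(F))$ induces a bijection $\pi_0(\mathrm{Faisc}^N(\mathbb R^2))\simeq\pi_0(\mathrm{LO}^N(\mathbb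 R^2))\times\{-1,1\}^N$. -/

import Mathlib

namespace OpticalBeam

/-- The Euclidean plane `ℝ²`. -/
abbrev Plane : Type := EuclideanSpace ℝ (Fin 2)

/-- `N`-polygonal chains `(c_0, …, c_{N+1})`, with the product topology of `(ℝ²)^(N+2)`. -/
abbrev Chain (N : ℕ) : Type := Fin (N + 2) → Plane

/-! For a mirror number `m ∈ {1, …, N}`, written `m = j + 1` with `j : Fin N`, the indices
`m - 1`, `m`, `m + 1` of `{0, …, N + 1}` are `pre j`, `mir j`, `nxt j`. -/

/-- The index `m - 1` of the point before the mirror `m = j + 1`. -/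
abbrev pre {N : ℕ} (j : Fin N) : Fin (N + 2) := j.castSucc.castSucc

/-- The index `m` of the mirror `m = j + 1`. -/
abbrev mir {N : ℕ} (j : Fin N) : Fin (N + 2) := j.castSucc.succ

/-- The index `m + 1` of the point after the mirror `m = j + 1`. -/
abbrev nxt {N : ℕ} (j : Fin N) : Fin (N + 2) := j.succ.succ

open Classical in
/-- The half-line `(x, y]` that ends at `y` and passes through `x`; it is empty if `x = y`. -/
noncomputable def halfLine (x y : Plane) : Set Plane :=
  if x = y then ∅ else {z | ∃ s : ℝ, 0 ≤ s ∧ z = y + s • (x - y)}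

/-- The `j`-th ray of a chain, `0 ≤ j ≤ N`: the half-line `(c_0, c_1]` for `j = 0`, and the
segment `[c_j, c_{j+1}]` for `j ≥ 1`. -/
noncomputable def ray {N : ℕ} (c : Chain N) (j : Fin (N + 1)) : Set Plane :=
  if j = 0 then halfLine (c 0) (c 1) else segment ℝ (c j.castSucc) (c j.succ)

/-- The obscuration clause: some ray is empty, or contains some `c_k` with `1 ≤ k ≤ N + 1` and
`k ≠ j, j + 1`. -/
def Obsc {N : ℕ} (c : Chain N) : Prop :=
  ∃ j : Fin (N + 1), ray c j = ∅ ∨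
    ∃ k : Fin (N + 2), k ≠ 0 ∧ k ≠ j.castSucc ∧ k ≠ j.succ ∧ c k ∈ ray c j

/-- The grazing clause: some mirror lies between its two neighbours. -/
def Graz {N : ℕ} (c : Chain N) : Prop :=
  ∃ j : Fin N, c (mir j) ∈ segment ℝ (c (pre j)) (c (nxt j))

/-- The space `LO^N(ℝ²)` of polygonal chains without obscuration and without grazing. -/
def LO (N : ℕ) : Set (Chain N) := {c | ¬ (Obsc c ∨ Graz c)}

/-- The angle `A(x) ∈ ℝ/2πℤ` of a nonzero vector `x`. -/
noncomputable def angle (x : Plane) : Real.Angle := (Complex.arg ⟨x 0, x 1⟩ : ℝ)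

/-- The unit normal `n(θ)` of a line of direction `(cos θ, sin θ)`. -/
noncomputable def unitNormal (θ : Real.Angle) : Plane := !₂[-θ.sin, θ.cos]

/-- The space `LR^N(ℝ²)` of reflexive polygonal chains `((c_i), (θ_m))`. -/
def LR (N : ℕ) : Set (Chain N × (Fin N → Real.Angle)) :=
  {L | L.1 ∈ LO N ∧ ∀ j : Fin N,
    SignType.sign (inner ℝ (L.1 (nxt j) - L.1 (mir j)) (unitNormal (L.2 j))) =
      SignType.sign (inner ℝ (L.1 (pre j) - L.1 (mir j)) (unitNormal (L.2 j))) ∧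
    SignType.sign (inner ℝ (L.1 (pre j) - L.1 (mir j)) (unitNormal (L.2 j))) ≠ 0}

/-- The open half-circle `x + e ]0, π[`, for `e = 1` or `e = -1`. -/
def halfCircle (x : Real.Angle) (e : ℤ) : Set Real.Angle :=
  {θ | ∃ s : ℝ, 0 < s ∧ s < Real.pi ∧ θ = x + e • (s : Real.Angle)}

/-- The positive orientations `(𝒜⁺)_m` of the mirror `m = j + 1`; here `(-1)^m = (-1)^(j+1)`. -/
def posOrient {N : ℕ} (c : Chain N) (j : Fin N) : Set Real.Angle :=
  halfCircle (angle (c (mir j) - c (pre j))) ((-1) ^ ((j : ℕ) + 1)) ∩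
    halfCircle (angle (c (mir j) - c (nxt j))) ((-1) ^ ((j : ℕ) + 1))

/-- The negative orientations `(𝒜⁻)_m` of the mirror `m = j + 1`. -/
def negOrient {N : ℕ} (c : Chain N) (j : Fin N) : Set Real.Angle :=
  halfCircle (angle (c (mir j) - c (pre j))) ((-1) ^ ((j : ℕ) + 2)) ∩
    halfCircle (angle (c (mir j) - c (nxt j))) ((-1) ^ ((j : ℕ) + 2))

open Classical in
/-- The characteristic `Car(L) ∈ {-1, 1}^N`: the entry is `1` on `(𝒜⁺)_m` and `-1` on `(𝒜⁻)_m`.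
For a reflexive chain exactly one of the two holds, see `car_eq_one_iff`, `car_eq_neg_one_iff`. -/
noncomputable def car {N : ℕ} (L : LR N) (j : Fin N) : ℤˣ :=
  if L.1.2 j ∈ posOrient L.1.1 j then 1 else -1

/-- Primary beams: pairs of chains `((a_i), (b_i))` with `a_m ≠ b_m` for `1 ≤ m ≤ N`,
`a_0 = b_0 = (-1, 0)`, `a_{N+1} = b_{N+1}` and `(a_1 + b_1)/2 = (0, 0)`. -/
def FaiscP (N : ℕ) : Set (Chain N × Chain N) :=
  {F | (∀ j : Fin N, F.1 (mir j) ≠ F.2 (mir j)) ∧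
    F.1 0 = !₂[-1, 0] ∧ F.2 0 = !₂[-1, 0] ∧
    F.1 (Fin.last (N + 1)) = F.2 (Fin.last (N + 1)) ∧
    midpoint ℝ (F.1 1) (F.2 1) = 0}

open Classical in
/-- One step of the `t`-chain. Light goes from the point `x = (1 - l) p + l q` of the segment
`[p, q]` to the segment `[p', q']`; the value is the parameter on `[p', q']` of the impact point.
If the lines `(p, p')` and `(q, q')` meet at a point `I`, the impact point is where the line
`(x, I)` meets `[p', q']`; otherwise the parameter is kept.
(For data with the reflexion property the line `(x, I)` does meet `[p', q']`, in one point.) -/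
noncomputable def nextParam (p q p' q' : Plane) (l : ℝ) : ℝ :=
  if h : ∃ s : ℝ, (0 ≤ s ∧ s ≤ 1) ∧ ∃ I : Plane, I ∈ line[ℝ, p, p'] ∧ I ∈ line[ℝ, q, q'] ∧
      AffineMap.lineMap p' q' s ∈ line[ℝ, AffineMap.lineMap p q l, I]
  then h.choose else l

/-- The parameters `λ_1 = t, λ_2, …, λ_{N+1}` of the impact points of the `t`-chain; the entry
with index `k` is `λ_{k+1}`. -/
noncomputable def impactParam {N : ℕ} (F : Chain N × Chain N) (t : ℝ) (k : Fin (N + 1)) : ℝ :=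
  Fin.induction (motive := fun _ => ℝ) t
    (fun j l => nextParam (F.1 (mir j)) (F.2 (mir j)) (F.1 (nxt j)) (F.2 (nxt j)) l) k

/-- The `t`-polygonal chain `P_t` of a primary beam: `P_0 = (1 - t) a_1 + t b_1 + a_0`, and
`P_i = (1 - λ_i) a_i + λ_i b_i` for `1 ≤ i ≤ N + 1`. -/
noncomputable def tChain {N : ℕ} (F : Chain N × Chain N) (t : ℝ) : Chain N :=
  Fin.cons (AffineMap.lineMap (F.1 1) (F.2 1) t + F.1 0)
    (fun k => AffineMap.lineMap (F.1 k.succ) (F.2 k.succ) (impactParam F t k))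

/-- Non-obscuration: no ray of a `t`-chain meets a non-adjacent `S_k = [a_k, b_k]`,
`1 ≤ k ≤ N + 1`. -/
def NonObscuration {N : ℕ} (F : Chain N × Chain N) : Prop :=
  ∀ j : Fin (N + 1), ∀ t : ℝ, 0 ≤ t → t ≤ 1 → ∀ k : Fin (N + 2),
    k ≠ 0 → k ≠ j.castSucc → k ≠ j.succ →
      ray (tChain F t) j ∩ segment ℝ (F.1 k) (F.2 k) = ∅

/-- The unit normal `n_m` of the mirror `S_m = [a_m, b_m]`, `m = j + 1`. -/
noncomputable def mirrorNormal {N : ℕ} (F : Chain N × Chain N) (j : Fin N) : Plane :=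
  unitNormal (angle (F.1 (mir j) - F.2 (mir j)))

/-- Reflexion: for each mirror, the points `a_{m-1}, b_{m-1}, a_{m+1}, b_{m+1}` lie strictly on
the same side of the line of the mirror `S_m`. -/
def Reflexion {N : ℕ} (F : Chain N × Chain N) : Prop :=
  ∀ j : Fin N,
    SignType.sign (inner ℝ (F.1 (pre j) - F.1 (mir j)) (mirrorNormal F j)) =
        SignType.sign (inner ℝ (F.2 (pre j) - F.2 (mir j)) (mirrorNormal F j)) ∧
    SignType.sign (inner ℝ (F.2 (pre j) - F.2 (mir j)) (mirrorNormal F j)) =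
        SignType.sign (inner ℝ (F.1 (nxt j) - F.1 (mir j)) (mirrorNormal F j)) ∧
    SignType.sign (inner ℝ (F.1 (nxt j) - F.1 (mir j)) (mirrorNormal F j)) =
        SignType.sign (inner ℝ (F.2 (nxt j) - F.2 (mir j)) (mirrorNormal F j)) ∧
    SignType.sign (inner ℝ (F.2 (nxt j) - F.2 (mir j)) (mirrorNormal F j)) ≠ 0

/-- The space `Faisc^N(ℝ²)` of beams, with the topology induced by `(ℝ²)^(2(N+2))`. -/
def Faisc (N : ℕ) : Set (Chain N × Chain N) :=
  {F | F ∈ FaiscP N ∧ NonObscuration F ∧ Reflexion F}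

/-! ### The maps `M`, `M_R` and the invariants are well defined -/

lemma inner_unitNormal (x : Plane) (θ : Real.Angle) :
    inner ℝ x (unitNormal θ) = x 1 * θ.cos - x 0 * θ.sin := by
  simp [unitNormal, PiLp.inner_apply, Fin.sum_univ_two]
  ring

lemma exists_polar (x : Plane) :
    ∃ r : ℝ, 0 ≤ r ∧ (x ≠ 0 → 0 < r) ∧ x 0 = r * (angle x).cos ∧ x 1 = r * (angle x).sin := by
  refine ⟨‖(⟨x 0, x 1⟩ : ℂ)‖, norm_nonneg _, fun hx => ?_, ?_, ?_⟩
  · rw [norm_pos_iff]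
    intro h
    apply hx
    ext i
    have h0 := congrArg Complex.re h
    have h1 := congrArg Complex.im h
    fin_cases i
    · simpa using h0
    · simpa using h1
  · simp [angle]
  · simp [angle]

/-- Membership in an open half-circle, through the sine. -/
lemma mem_halfCircle {x θ : Real.Angle} {e : ℤ} (he : e = 1 ∨ e = -1) :
    θ ∈ halfCircle x e ↔ 0 < (e : ℝ) * (θ - x).sin := by
  have key : ∀ φ : Real.Angle, 0 < φ.sin ↔ ∃ s : ℝ, 0 < s ∧ s < Real.pi ∧ φ = s := by
    intro φ
    constructor
    · intro h
      refine ⟨φ.toReal, ?_, ?_, φ.coe_toReal.symm⟩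
      · by_contra hneg
        rw [← Real.Angle.sin_toReal] at h
        have := Real.sin_nonpos_of_nonpos_of_neg_pi_le (not_lt.1 hneg) φ.neg_pi_lt_toReal.le
        linarith
      · refine lt_of_le_of_ne φ.toReal_le_pi fun hpi => ?_
        rw [← Real.Angle.sin_toReal, hpi, Real.sin_pi] at h
        exact lt_irrefl _ h
    · rintro ⟨s, h0, h1, rfl⟩
      exact Real.sin_pos_of_pos_of_lt_pi h0 h1
  rcases he with rfl | rfl
  · simp only [halfCircle, Set.mem_ofPred_eq, Int.cast_one, one_mul, one_smul, key]
    simp only [sub_eq_iff_eq_add']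
  · have h : ((-1 : ℤ) : ℝ) * (θ - x).sin = (x - θ).sin := by
      rw [← neg_sub x θ, Real.Angle.sin_neg]
      simp
    simp only [halfCircle, Set.mem_ofPred_eq, neg_smul, one_smul, h, key]
    refine exists_congr fun s => and_congr_right fun _ => and_congr_right fun _ => ?_
    constructor
    · rintro rfl
      abel
    · intro h
      rw [← h]
      abel

/-- The reflexive condition in terms of the sine of the angle with an adjacent ray. -/
lemma sign_inner_unitNormal {c y : Plane} {θ : Real.Angle}
    (h : SignType.sign (inner ℝ (y - c) (unitNormal θ)) ≠ 0) :
    SignType.sign (inner ℝ (y - c) (unitNormal θ)) =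
      SignType.sign (θ - angle (c - y)).sin := by
  obtain ⟨r, -, hr, h0, h1⟩ := exists_polar (c - y)
  have hr : 0 < r := by
    apply hr
    intro hz
    rw [← neg_sub, hz, neg_zero, inner_zero_left, sign_zero] at h
    exact h rfl
  have : inner ℝ (y - c) (unitNormal θ) = r * (θ - angle (c - y)).sin := by
    rw [← neg_sub, inner_neg_left, inner_unitNormal, h0, h1, sub_eq_add_neg θ, Real.Angle.sin_add,
      Real.Angle.sin_neg, Real.Angle.cos_neg]
    ring
  rw [this, sign_mul, sign_pos hr, one_mul]

lemma mem_posOrient_or_mem_negOrient {N : ℕ} (L : LR N) (j : Fin N) :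
    (L.1.2 j ∈ posOrient L.1.1 j ∧ L.1.2 j ∉ negOrient L.1.1 j) ∨
      (L.1.2 j ∉ posOrient L.1.1 j ∧ L.1.2 j ∈ negOrient L.1.1 j) := by
  obtain ⟨h1, h2⟩ := L.2.2 j
  have h3 := h1 ▸ h2
  rw [sign_inner_unitNormal h2, sign_inner_unitNormal h3] at h1
  rw [sign_inner_unitNormal h2] at h2
  set x := (L.1.2 j - angle (L.1.1 (mir j) - L.1.1 (pre j))).sin with hx
  set y := (L.1.2 j - angle (L.1.1 (mir j) - L.1.1 (nxt j))).sin with hy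
  have hs : ((-1 : ℤ) ^ ((j : ℕ) + 2)) = -((-1 : ℤ) ^ ((j : ℕ) + 1)) := by ring
  have he := neg_one_pow_eq_or ℤ ((j : ℕ) + 1)
  have he' : -((-1 : ℤ) ^ ((j : ℕ) + 1)) = 1 ∨ -((-1 : ℤ) ^ ((j : ℕ) + 1)) = -1 := by
    rcases he with h | h <;> simp [h]
  simp only [posOrient, negOrient, hs, Set.mem_inter_iff]
  rw [mem_halfCircle he, mem_halfCircle he, mem_halfCircle he', mem_halfCircle he', ← hx, ← hy]
  have hxy : (0 < x ∧ 0 < y) ∨ (x < 0 ∧ y < 0) := by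
    rcases lt_trichotomy x 0 with hx0 | hx0 | hx0
    · rw [sign_neg hx0, sign_eq_neg_one_iff] at h1
      exact Or.inr ⟨hx0, h1⟩
    · rw [hx0, sign_zero] at h2
      exact absurd rfl h2
    · rw [sign_pos hx0, sign_eq_one_iff] at h1
      exact Or.inl ⟨hx0, h1⟩
  rcases he with h | h <;> rw [h] <;> rcases hxy with ⟨hx0, hy0⟩ | ⟨hx0, hy0⟩ <;>
    simp [hx0, hy0, hx0.not_gt]

lemma car_eq_one_iff {N : ℕ} (L : LR N) (j : Fin N) :
    car L j = 1 ↔ L.1.2 j ∈ posOrient L.1.1 j := by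
  unfold car
  split_ifs with h <;> simp [h]

lemma car_eq_neg_one_iff {N : ℕ} (L : LR N) (j : Fin N) :
    car L j = -1 ↔ L.1.2 j ∈ negOrient L.1.1 j := by
  unfold car
  rcases mem_posOrient_or_mem_negOrient L j with ⟨h1, h2⟩ | ⟨h1, h2⟩ <;> simp [h1, h2]

lemma inner_unitNormal_angle_self (x : Plane) : inner ℝ x (unitNormal (angle x)) = 0 := by
  obtain ⟨r, -, -, h0, h1⟩ := exists_polar x
  rw [inner_unitNormal, h0, h1]
  ring

lemma nextParam_mem (p q p' q' : Plane) {l : ℝ} (hl : 0 ≤ l ∧ l ≤ 1) :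
    0 ≤ nextParam p q p' q' l ∧ nextParam p q p' q' l ≤ 1 := by
  unfold nextParam
  split_ifs with h
  · exact h.choose_spec.1
  · exact hl

lemma impactParam_mem {N : ℕ} (F : Chain N × Chain N) {t : ℝ} (ht : 0 ≤ t ∧ t ≤ 1)
    (k : Fin (N + 1)) : 0 ≤ impactParam F t k ∧ impactParam F t k ≤ 1 := by
  induction k using Fin.induction with
  | zero => simpa [impactParam] using ht
  | succ j ih => simpa [impactParam] using nextParam_mem _ _ _ _ ih

lemma tChain_zero {N : ℕ} (F : Chain N × Chain N) (t : ℝ) :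
    tChain F t 0 = AffineMap.lineMap (F.1 1) (F.2 1) t + F.1 0 := rfl

lemma tChain_succ {N : ℕ} (F : Chain N × Chain N) (t : ℝ) (k : Fin (N + 1)) :
    tChain F t k.succ = AffineMap.lineMap (F.1 k.succ) (F.2 k.succ) (impactParam F t k) := rfl

lemma tChain_one {N : ℕ} (F : Chain N × Chain N) (t : ℝ) :
    tChain F t 1 = AffineMap.lineMap (F.1 1) (F.2 1) t := rfl

lemma tChain_mem_segment {N : ℕ} (F : Chain N × Chain N) {t : ℝ} (ht : 0 ≤ t ∧ t ≤ 1)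
    (k : Fin (N + 2)) (hk : k ≠ 0) : tChain F t k ∈ segment ℝ (F.1 k) (F.2 k) := by
  obtain ⟨k, rfl⟩ := Fin.exists_succ_eq.2 hk
  rw [tChain_succ, segment_eq_image_lineMap]
  exact ⟨_, impactParam_mem F ht k, rfl⟩

lemma inner_mirrorNormal_eq {N : ℕ} (F : Chain N × Chain N) (j : Fin N) :
    inner ℝ (F.1 (mir j)) (mirrorNormal F j) = inner ℝ (F.2 (mir j)) (mirrorNormal F j) := by
  have h := inner_unitNormal_angle_self (F.1 (mir j) - F.2 (mir j))
  rw [inner_sub_left] at h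
  exact sub_eq_zero.1 h

lemma inner_lineMap (p q n : Plane) (l : ℝ) :
    inner ℝ (AffineMap.lineMap p q l) n = (1 - l) * inner ℝ p n + l * inner ℝ q n := by
  rw [AffineMap.lineMap_apply_module, inner_add_left, real_inner_smul_left, real_inner_smul_left]

lemma sign_convex {x y l : ℝ} {σ : SignType} (hl : 0 ≤ l ∧ l ≤ 1) (hσ : σ ≠ 0)
    (hx : SignType.sign x = σ) (hy : SignType.sign y = σ) :
    SignType.sign ((1 - l) * x + l * y) = σ := by
  have key : ∀ u v : ℝ, 0 < u → 0 < v → 0 < (1 - l) * u + l * v := by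
    intro u v hu hv
    rcases hl.1.eq_or_lt with h | h
    · simpa [← h] using hu
    · have := mul_nonneg (sub_nonneg.2 hl.2) hu.le
      have := mul_pos h hv
      linarith
  cases σ with
  | zero => exact absurd rfl hσ
  | neg =>
    rw [SignType.neg_eq_neg_one, sign_eq_neg_one_iff] at *
    have := key (-x) (-y) (by linarith) (by linarith)
    nlinarith
  | pos =>
    rw [SignType.pos_eq_one, sign_eq_one_iff] at *
    exact key x y hx hy

/-- The common sign of the reflexion property holds for the neighbours in every `t`-chain. -/
lemma sign_tChain {N : ℕ} {F : Chain N × Chain N} (hF : F ∈ Faisc N) {t : ℝ}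
    (ht : 0 ≤ t ∧ t ≤ 1) (j : Fin N) :
    SignType.sign (inner ℝ (tChain F t (nxt j) - tChain F t (mir j)) (mirrorNormal F j)) =
      SignType.sign (inner ℝ (tChain F t (pre j) - tChain F t (mir j)) (mirrorNormal F j)) ∧
    SignType.sign (inner ℝ (tChain F t (pre j) - tChain F t (mir j)) (mirrorNormal F j)) ≠ 0 := by
  obtain ⟨⟨-, ha0, hb0, -, hmid⟩, -, hR⟩ := hF
  obtain ⟨h1, h2, h3, h4⟩ := hR j
  have hn := inner_mirrorNormal_eq F j
  set n := mirrorNormal F j with hn_def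
  set σ := SignType.sign (inner ℝ (F.2 (nxt j) - F.2 (mir j)) n) with hσ
  have hm : inner ℝ (tChain F t (mir j)) n = inner ℝ (F.1 (mir j)) n := by
    rw [tChain_succ, inner_lineMap]
    rw [← hn]
    ring
  have aux : ∀ k : Fin (N + 2), k ≠ 0 →
      SignType.sign (inner ℝ (F.1 k - F.1 (mir j)) n) = σ →
      SignType.sign (inner ℝ (F.2 k - F.2 (mir j)) n) = σ →
      SignType.sign (inner ℝ (tChain F t k - tChain F t (mir j)) n) = σ := by
    intro k hk hx hy
    obtain ⟨k, rfl⟩ := Fin.exists_succ_eq.2 hk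
    have := sign_convex (impactParam_mem F ht k) h4 hx hy
    rw [← this, tChain_succ, inner_sub_left, hm, inner_lineMap, inner_sub_left, inner_sub_left,
      ← hn]
    congr 1
    ring
  have hnext := aux (nxt j) (Fin.succ_ne_zero _) h3 rfl
  have hprev : SignType.sign (inner ℝ (tChain F t (pre j) - tChain F t (mir j)) n) = σ := by
    by_cases hj : pre j = 0
    · have hj1 : mir j = 1 := by
        have := congrArg Fin.val hj
        apply Fin.ext
        simp at this
        simp [mir, this]
      have hx : inner ℝ (F.1 1) n = 0 := by
        have h := congrArg (fun v => inner ℝ v n) hmid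
        simp only [midpoint, inner_lineMap, inner_zero_left] at h
        rw [hj1] at hn
        rw [← hn] at h
        simpa using (by linarith : inner ℝ (F.1 1) n = 0)
      rw [hj, hj1] at h1 h2 ⊢
      rw [tChain_zero, tChain_one, add_sub_cancel_left]
      rw [inner_sub_left, hx, sub_zero] at h1
      rw [h1, h2, ← h3, hj1]
    · exact aux _ hj (h1.trans (h2.trans h3)) (h2.trans h3)
  exact ⟨hnext.trans hprev.symm, hprev ▸ h4⟩

/-- Every `t`-polygonal chain of a beam belongs to `LO^N(ℝ²)`. -/
lemma tChain_mem_LO {N : ℕ} {F : Chain N × Chain N} (hF : F ∈ Faisc N) {t : ℝ}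
    (ht : 0 ≤ t ∧ t ≤ 1) : tChain F t ∈ LO N := by
  rintro (⟨j, h | ⟨k, hk0, hk1, hk2, hk⟩⟩ | ⟨j, hj⟩)
  · unfold ray at h
    split_ifs at h with hj
    · unfold halfLine at h
      split_ifs at h with h01
      · rw [tChain_zero, tChain_one, hF.1.2.1] at h01
        have := congrArg (fun v : Plane => v 0) (add_eq_left.1 h01)
        simp at this
      · exact (Set.eq_empty_iff_forall_notMem.1 h _) ⟨0, le_rfl, rfl⟩
    · exact (Set.eq_empty_iff_forall_notMem.1 h _) (left_mem_segment ℝ _ _)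
  · exact (Set.eq_empty_iff_forall_notMem.1 (hF.2.1 j t ht.1 ht.2 k hk0 hk1 hk2) _)
      ⟨hk, tChain_mem_segment F ht k hk0⟩
  · obtain ⟨h1, h2⟩ := sign_tChain hF ht j
    rw [segment_eq_image_lineMap] at hj
    obtain ⟨s, hs, h⟩ := hj
    have h3 := sign_convex hs h2 rfl h1
    rw [← h3] at h2
    apply h2
    have h4 := congrArg (fun v => inner ℝ v (mirrorNormal F j)) h
    simp only [inner_lineMap] at h4
    rw [sign_eq_zero_iff, inner_sub_left, inner_sub_left]
    linarith

lemma half_mem : (0 : ℝ) ≤ 1 / 2 ∧ (1 / 2 : ℝ) ≤ 1 := by norm_num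

/-- The centered polygonal chain `M(F) = P_{1/2}` of a beam. -/
noncomputable def centeredChain {N : ℕ} (F : Faisc N) : LO N :=
  ⟨tChain F.1 (1 / 2), tChain_mem_LO F.2 half_mem⟩

/-- The map `M_R : Faisc^N(ℝ²) → LR^N(ℝ²)`, with `θ_m = A(a_m - b_m)`. -/
noncomputable def toReflexive {N : ℕ} (F : Faisc N) : LR N :=
  ⟨(tChain F.1 (1 / 2), fun j => angle (F.1.1 (mir j) - F.1.2 (mir j))),
    tChain_mem_LO F.2 half_mem, fun j => sign_tChain F.2 half_mem j⟩

/-- The nomenclature `N`: the connected component in `LO^N(ℝ²)`. -/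
def nomenclature {N : ℕ} (L : LO N) : ConnectedComponents (LO N) := ConnectedComponents.mk L

/-- The nomenclature `N^F(F) = N(M(F))` of a beam. -/
noncomputable def nomenclatureF {N : ℕ} (F : Faisc N) : ConnectedComponents (LO N) :=
  nomenclature (centeredChain F)

/-- The characteristic `Car^F(F) = Car(M_R(F))` of a beam. -/
noncomputable def carF {N : ℕ} (F : Faisc N) : Fin N → ℤˣ := car (toReflexive F)

/-- The invariant `I^F = (N^F, Car^F)`. -/
noncomputable def invariantF {N : ℕ} (F : Faisc N) :
    ConnectedComponents (LO N) × (Fin N → ℤˣ) :=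
  (nomenclatureF F, carF F)

end OpticalBeam

/-! A beam can be squeezed onto its centered chain without changing that chain, and thin beams are
governed by an open condition on a chain equipped with mirror directions. This reduces paths of
beams to paths of such pairs.

Squeezing. Between two mirrors that face each other, impact parameters correspond by a homography
that fixes 0 and 1 and has positive coefficient (`nextParam_eq`). Such maps are increasing, depend
continuously on the data, and restrict to subsegments as maps of the same kind
(`homography_lineMap`, `ratio_lineMap`). Hence the chains of the part of a beam between two of its
chains are again chains of the beam (`tChain_subBeam`), and shrinking the time interval around 1/2
is a path of beams (`joined_subBeam`).

Thin beams. The pairs (chain, directions) of characteristic `χ` form an open set `Adm χ`. A primary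
beam is a beam as soon as all chains with vertices on its mirrors lie in `Adm χ`
(`mem_Faisc_of_thin`), and compactness gives one admissible width along a whole path of pairs
(`exists_uniform_thin`).

Pairs. `LO N` is open, so its components are path components; similarities preserve it and normalize
the first two vertices. For a fixed chain the admissible directions form convex cones, in which the
bisector is a continuous choice. So normalized pairs with the same invariants are joined
(`joinedIn_Adm`). Two beams with equal invariants are joined by squeezing the first, following
pencils along this path, and widening to the second (`joined_of_invariant_eq`). Pencils in the
bisector directions realize every invariant (`surjective_invariantF`), and continuity of the
invariant into a totally disconnected space makes it constant on components. -/

namespace OpticalBeam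

/-! ### Propagation between two mirrors as a homography -/

/-- The determinant of two vectors of the plane. -/
def det (x y : Plane) : ℝ := x 0 * y 1 - x 1 * y 0

/-- The points `p`, `q` lie strictly on one side of the line `(p'q')`, and `p'`, `q'` strictly on
one side of the line `(pq)`. -/
def Facing (p q p' q' : Plane) : Prop :=
  0 < det (q - p) (p' - p) * det (q - p) (q' - p) ∧
    0 < det (q' - p') (p - p') * det (q' - p') (q - p')

/-- The coefficient of the homography that sends the impact points on `[p, q]` to those on
`[p', q']`. -/
noncomputable def ratio (p q p' q' : Plane) : ℝ :=
  (det (q' - p') (q - p') * det (q - p) (p' - p)) /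
    (det (q - p) (q' - p) * det (q' - p') (p - p'))

/-- The homography of the line that fixes `0` and `1`, with coefficient `r`. -/
noncomputable def homography (r l : ℝ) : ℝ := l * r / (1 - l + l * r)

lemma ratio_pos {p q p' q' : Plane} (h : Facing p q p' q') : 0 < ratio p q p' q' := by
  obtain ⟨h1, h2⟩ := h
  have h3 := mul_pos h1 h2
  have : 0 < (det (q' - p') (q - p') * det (q - p) (p' - p)) *
      (det (q - p) (q' - p) * det (q' - p') (p - p')) := by
    calc _ < _ := h3
      _ = _ := by ring
  rw [ratio]
  rcases pos_and_pos_or_neg_and_neg_of_mul_pos this with h | h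
  · exact div_pos h.1 h.2
  · exact div_pos_of_neg_of_neg h.1 h.2

lemma homography_denom_pos {r l : ℝ} (hr : 0 < r) (hl : 0 ≤ l ∧ l ≤ 1) : 0 < 1 - l + l * r := by
  rcases hl.1.eq_or_lt with h | h
  · simp [← h]
  · have := mul_pos h hr
    linarith [hl.2]

lemma homography_mem {r l : ℝ} (hr : 0 < r) (hl : 0 ≤ l ∧ l ≤ 1) :
    0 ≤ homography r l ∧ homography r l ≤ 1 := by
  have h := homography_denom_pos hr hl
  have := mul_nonneg hl.1 hr.le
  exact ⟨div_nonneg this h.le, (div_le_one h).2 (by linarith [hl.2])⟩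

lemma homography_lt {r l m : ℝ} (hr : 0 < r) (hl : 0 ≤ l ∧ l ≤ 1) (hm : 0 ≤ m ∧ m ≤ 1)
    (hlm : l < m) : homography r l < homography r m := by
  rw [homography, homography, div_lt_div_iff₀ (homography_denom_pos hr hl)
    (homography_denom_pos hr hm)]
  have := mul_pos (sub_pos.2 hlm) hr
  nlinarith

/-- The restriction of a homography to a subsegment. -/
lemma homography_lineMap {r l m u : ℝ} (hr : 0 < r) (hl : 0 ≤ l ∧ l ≤ 1) (hm : 0 ≤ m ∧ m ≤ 1)
    (hu : 0 ≤ u ∧ u ≤ 1) :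
    homography r (AffineMap.lineMap l m u) =
      AffineMap.lineMap (homography r l) (homography r m)
        (homography ((1 - m + m * r) / (1 - l + l * r)) u) := by
  have h1 := homography_denom_pos hr hl
  have h2 := homography_denom_pos hr hm
  have h3 : 0 < (1 - u) * (1 - l + l * r) + u * (1 - m + m * r) := by
    rcases hu.1.eq_or_lt with h | h
    · simpa [← h] using h1
    · have := mul_pos h h2
      have := mul_nonneg (sub_nonneg.2 hu.2) h1.le
      linarith
  have e1 : homography ((1 - m + m * r) / (1 - l + l * r)) u =
      u * (1 - m + m * r) / ((1 - u) * (1 - l + l * r) + u * (1 - m + m * r)) := by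
    have h4 : (1 - u + u * ((1 - m + m * r) / (1 - l + l * r))) * (1 - l + l * r) =
        (1 - u) * (1 - l + l * r) + u * (1 - m + m * r) := by
      rw [add_mul, mul_assoc, div_mul_cancel₀ _ h1.ne']
    rw [homography, ← h4, mul_div_assoc', div_div, mul_comm (1 - l + l * r)]
  have e2 : homography r (AffineMap.lineMap l m u) =
      ((1 - u) * l + u * m) * r / ((1 - u) * (1 - l + l * r) + u * (1 - m + m * r)) := by
    rw [homography, AffineMap.lineMap_apply_module]
    simp only [smul_eq_mul]
    congr 1
    ring
  rw [e1, e2, AffineMap.lineMap_apply_module, homography, homography]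
  simp only [smul_eq_mul]
  set d₁ := 1 - l + l * r
  set d₂ := 1 - m + m * r
  clear_value d₁ d₂
  field_simp
  ring

lemma Plane.ext_iff {x y : Plane} : x = y ↔ x 0 = y 0 ∧ x 1 = y 1 := by
  refine ⟨fun h => by simp [h], fun h => ?_⟩
  ext i
  fin_cases i
  · exact h.1
  · exact h.2

lemma lineMap_coord (p q : Plane) (l : ℝ) (i : Fin 2) :
    AffineMap.lineMap p q l i = p i + l * (q i - p i) := by
  simp [AffineMap.lineMap_apply]
  ring

lemma mem_line_iff {p q x : Plane} :
    x ∈ line[ℝ, p, q] ↔ ∃ a : ℝ, x = AffineMap.lineMap p q a := by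
  rw [mem_affineSpan_pair_iff_exists_lineMap_eq]
  exact exists_congr fun _ => eq_comm

/-- The cross-multiplied form is what a collinearity condition produces. Since `R` and `S` have the
same sign, the denominator of the homography does not vanish on the unit interval. -/
lemma eq_homography_iff {R S l s : ℝ} (hRS : 0 < R * S) (hl : 0 ≤ l ∧ l ≤ 1) :
    s = homography (R / S) l ↔ l * (1 - s) * R = (1 - l) * s * S := by
  have hS : S ≠ 0 := right_ne_zero_of_mul hRS.ne'
  have hr : 0 < R / S := by
    have : R / S = R * S / S ^ 2 := by field_simp
    rw [this]
    positivity
  have h := homography_denom_pos hr hl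
  rw [homography, eq_div_iff h.ne']
  have e : s * (1 - l + l * (R / S)) - l * (R / S) = ((1 - l) * s * S - l * (1 - s) * R) / S := by
    field_simp
    ring
  rw [← sub_eq_zero, e, div_eq_zero_iff, sub_eq_zero]
  simp [hS, eq_comm]

/-- The impact point is given by a homography. -/
lemma nextParam_eq {p q p' q' : Plane} (h : Facing p q p' q') {l : ℝ} (hl : 0 ≤ l ∧ l ≤ 1) :
    nextParam p q p' q' l = homography (ratio p q p' q') l := by
  have hRS : 0 < (det (q' - p') (q - p') * det (q - p) (p' - p)) *
      (det (q - p) (q' - p) * det (q' - p') (p - p')) := by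
    calc _ < _ := mul_pos h.1 h.2
      _ = _ := by ring
  unfold nextParam
  split_ifs with hex
  · obtain ⟨-, I, hI1, hI2, hI3⟩ := hex.choose_spec
    set s := hex.choose
    rw [mem_line_iff] at hI1 hI2 hI3
    obtain ⟨a, hI1⟩ := hI1
    obtain ⟨b, hI2⟩ := hI2
    obtain ⟨g, hI3⟩ := hI3
    rw [ratio, eq_homography_iff hRS hl]
    have a0 := congrArg (fun v : Plane => v 0) hI1
    have a1 := congrArg (fun v : Plane => v 1) hI1
    have b0 := congrArg (fun v : Plane => v 0) hI2
    have b1 := congrArg (fun v : Plane => v 1) hI2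
    have c0 := congrArg (fun v : Plane => v 0) hI3
    have c1 := congrArg (fun v : Plane => v 1) hI3
    simp only [lineMap_coord] at a0 a1 b0 b1 c0 c1
    -- From I = p + a(p' - p) = q + b(q' - q), the vector q - p is a combination of the two line
    -- directions, so each determinant in `ratio` is a multiple of `d`. The coefficient becomes (1 -
    -- a)b / (a(1 - b)).
    set d := det (p' - p) (q' - q) with hd
    have e1 : det (q - p) (p' - p) = b * d := by
      simp only [hd, det, PiLp.sub_apply]
      linear_combination (p' 1 - p 1) * (a0 - b0) - (p' 0 - p 0) * (a1 - b1)
    have e2 : det (q - p) (q' - p) = a * d := by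
      simp only [hd, det, PiLp.sub_apply]
      linear_combination (q' 1 - q 1) * (a0 - b0) - (q' 0 - q 0) * (a1 - b1)
    have e3 : det (q' - p') (p - p') = (1 - b) * d := by
      simp only [hd, det, PiLp.sub_apply]
      linear_combination (-(p' 1 - p 1)) * (a0 - b0) + (p' 0 - p 0) * (a1 - b1)
    have e4 : det (q' - p') (q - p') = (1 - a) * d := by
      simp only [hd, det, PiLp.sub_apply]
      linear_combination (-(q' 1 - q 1)) * (a0 - b0) + (q' 0 - q 0) * (a1 - b1)
    -- Collinearity of the starting point, I and the impact point, with the vectors from I expanded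
    -- in the directions p' - p and q' - q.
    have e5 : d * (l * b * (1 - s) * (1 - a) - (1 - l) * a * s * (1 - b)) = 0 := by
      have x0 : p 0 + l * (q 0 - p 0) - I 0 =
          -((1 - l) * a * (p' 0 - p 0)) - l * b * (q' 0 - q 0) := by
        linear_combination -(1 - l) * a0 - l * b0
      have x1 : p 1 + l * (q 1 - p 1) - I 1 =
          -((1 - l) * a * (p' 1 - p 1)) - l * b * (q' 1 - q 1) := by
        linear_combination -(1 - l) * a1 - l * b1
      have y0 : p' 0 + s * (q' 0 - p' 0) - I 0 =
          (1 - s) * (1 - a) * (p' 0 - p 0) + s * (1 - b) * (q' 0 - q 0) := by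
        linear_combination -(1 - s) * a0 - s * b0
      have y1 : p' 1 + s * (q' 1 - p' 1) - I 1 =
          (1 - s) * (1 - a) * (p' 1 - p 1) + s * (1 - b) * (q' 1 - q 1) := by
        linear_combination -(1 - s) * a1 - s * b1
      have z : (p 0 + l * (q 0 - p 0) - I 0) * (p' 1 + s * (q' 1 - p' 1) - I 1) -
          (p 1 + l * (q 1 - p 1) - I 1) * (p' 0 + s * (q' 0 - p' 0) - I 0) = 0 := by
        rw [c0, c1]
        ring
      rw [x0, x1, y0, y1] at z
      simp only [hd, det, PiLp.sub_apply]
      linear_combination z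
    rw [e1, e2, e3, e4]
    linear_combination d * e5
  -- For parallel directions the numerator and denominator of `ratio` agree, so the homography is
  -- the identity, as in the default branch of `nextParam`. Otherwise an impact point exists and
  -- this branch is impossible.
  · by_cases hd : det (p' - p) (q' - q) = 0
    · rw [ratio, eq_homography_iff hRS hl]
      have : det (q' - p') (q - p') * det (q - p) (p' - p) -
          det (q - p) (q' - p) * det (q' - p') (p - p') =
          det (p' - p) (q' - q) * (det (q - p) (p' - p) - det (q - p) (q' - q)) := by
        simp only [det, PiLp.sub_apply]
        ring
      rw [hd, zero_mul, sub_eq_zero] at this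
      rw [this]
      ring
    · exfalso
      apply hex
      set d := det (p' - p) (q' - q) with hd'
      -- Cramer's rule for the parameters of the intersection point on the two lines.
      set a := det (q - p) (q' - q) / d with ha
      set b := det (q - p) (p' - p) / d with hb
      have e1 : det (q - p) (p' - p) = b * d := by rw [hb]; field_simp
      have e0 : det (q - p) (q' - q) = a * d := by rw [ha]; field_simp
      have e2 : det (q - p) (q' - p) = a * d := by
        rw [← e0]; simp only [det, PiLp.sub_apply]; ring
      have e3 : det (q' - p') (p - p') = (1 - b) * d := by
        rw [sub_mul, ← e1, hd']; simp only [det, PiLp.sub_apply]; ring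
      have e4 : det (q' - p') (q - p') = (1 - a) * d := by
        rw [sub_mul, ← e0, hd']; simp only [det, PiLp.sub_apply]; ring
      have hr := ratio_pos h
      have h0 : p 0 + a * (p' 0 - p 0) - (q 0 + b * (q' 0 - q 0)) = 0 := by
        have : (p 0 - q 0) * d + (a * d) * (p' 0 - p 0) - (b * d) * (q' 0 - q 0) = 0 := by
          rw [← e0, ← e1, hd']; simp only [det, PiLp.sub_apply]; ring
        apply mul_right_cancel₀ hd
        linear_combination this
      have h1 : p 1 + a * (p' 1 - p 1) - (q 1 + b * (q' 1 - q 1)) = 0 := by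
        have : (p 1 - q 1) * d + (a * d) * (p' 1 - p 1) - (b * d) * (q' 1 - q 1) = 0 := by
          rw [← e0, ← e1, hd']; simp only [det, PiLp.sub_apply]; ring
        apply mul_right_cancel₀ hd
        linear_combination this
      refine ⟨homography (ratio p q p' q') l, homography_mem hr hl,
        AffineMap.lineMap p p' a, mem_line_iff.2 ⟨a, rfl⟩, mem_line_iff.2 ⟨b, ?_⟩, ?_⟩
      · rw [Plane.ext_iff]
        simp only [lineMap_coord]
        exact ⟨sub_eq_zero.1 h0, sub_eq_zero.1 h1⟩
      · rw [mem_line_iff]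
        set s := homography (ratio p q p' q') l with hs
        have h5 : l * (1 - s) * ((1 - a) * b) = (1 - l) * s * (a * (1 - b)) := by
          have := (eq_homography_iff hRS hl).1 hs
          rw [e1, e2, e3, e4] at this
          have hd2 : d * d ≠ 0 := mul_ne_zero hd hd
          apply mul_right_cancel₀ hd2
          linear_combination this
        -- By `Facing`, the two products weighted by l and 1 - l have the same sign, so `D` is
        -- nonzero. It is the denominator of both the impact parameter and the position of the
        -- impact point on the line through I.
        set D := l * ((1 - a) * b) + (1 - l) * (a * (1 - b)) with hD
        have hD0 : D ≠ 0 := by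
          have h6 : 0 < ((1 - a) * b) * (a * (1 - b)) := by
            rw [e1, e2, e3, e4] at hRS
            by_contra hneg
            have := mul_nonpos_of_nonpos_of_nonneg (not_lt.1 hneg) (by positivity : 0 ≤ (d * d) ^ 2)
            nlinarith
          rcases pos_and_pos_or_neg_and_neg_of_mul_pos h6 with ⟨h7, h8⟩ | ⟨h7, h8⟩
          · rcases hl.1.eq_or_lt with h9 | h9
            · rw [hD, ← h9]; simpa using h8.ne'
            · have := mul_pos h9 h7
              have := mul_nonneg (sub_nonneg.2 hl.2) h8.le
              linarith
          · rcases hl.1.eq_or_lt with h9 | h9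
            · rw [hD, ← h9]; simpa using h8.ne
            · have := mul_neg_of_pos_of_neg h9 h7
              have := mul_nonpos_of_nonneg_of_nonpos (sub_nonneg.2 hl.2) h8.le
              exact ne_of_lt (by linarith)
        refine ⟨1 + (1 - a) * (1 - b) / D, ?_⟩
        have hs' : s * D = l * ((1 - a) * b) := by linear_combination -h5
        have hg : (1 + (1 - a) * (1 - b) / D) * D = D + (1 - a) * (1 - b) := by field_simp
        clear_value a b s D d
        rw [Plane.ext_iff]
        simp only [lineMap_coord]
        constructor
        · apply mul_right_cancel₀ hD0
          linear_combination (q' 0 - p' 0) * hs' -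
            (p 0 + a * (p' 0 - p 0) - (p 0 + l * (q 0 - p 0))) * hg +
            ((1 - a) * (p' 0 - p 0)) * hD - l * (1 - a) * h0
        · apply mul_right_cancel₀ hD0
          linear_combination (q' 1 - p' 1) * hs' -
            (p 1 + a * (p' 1 - p 1) - (p 1 + l * (q 1 - p 1))) * hg +
            ((1 - a) * (p' 1 - p 1)) * hD - l * (1 - a) * h1

/-! ### Reflexion expressed by determinants -/

lemma det_smul_left (k : ℝ) (x y : Plane) : det (k • x) y = k * det x y := by
  simp [det]
  ring

/-- Moving the base point along the mirror line does not change the determinant. The pairing of x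
with a and of y with b matches the reflexion condition. -/
lemma det_lineMap_sub_lineMap (a b x y : Plane) (l m : ℝ) :
    det (a - b) (AffineMap.lineMap x y l - AffineMap.lineMap a b m) =
      (1 - l) * det (a - b) (x - a) + l * det (a - b) (y - b) := by
  simp only [det, PiLp.sub_apply, lineMap_coord]
  ring

lemma lineMap_sub_lineMap_self (a b : Plane) (l m : ℝ) :
    AffineMap.lineMap a b l - AffineMap.lineMap a b m = (m - l) • (a - b) := by
  rw [Plane.ext_iff]
  simp only [PiLp.sub_apply, lineMap_coord, PiLp.smul_apply, smul_eq_mul]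
  constructor <;> ring

/-- The unit normal is v turned by a quarter turn and scaled to length one, so the determinant is a
positive multiple of the inner product. -/
lemma sign_inner_unitNormal_angle {v : Plane} (hv : v ≠ 0) (x : Plane) :
    SignType.sign (inner ℝ x (unitNormal (angle v))) = SignType.sign (det v x) := by
  obtain ⟨r, -, hr, h0, h1⟩ := exists_polar v
  have : det v x = r * inner ℝ x (unitNormal (angle v)) := by
    rw [det, inner_unitNormal, h0, h1]
    ring
  rw [this, sign_mul, sign_pos (hr hv), one_mul]

/-- A common multiplier τ replaces equality of nonzero signs by strict linear inequalities, which
pass to convex combinations. -/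
lemma exists_mul_pos_iff {w x y z : ℝ} :
    (SignType.sign w = SignType.sign x ∧ SignType.sign x = SignType.sign y ∧
      SignType.sign y = SignType.sign z ∧ SignType.sign z ≠ 0) ↔
    ∃ τ : ℝ, 0 < τ * w ∧ 0 < τ * x ∧ 0 < τ * y ∧ 0 < τ * z := by
  constructor
  · rintro ⟨h1, h2, h3, h4⟩
    rcases lt_trichotomy z 0 with hz | hz | hz
    · rw [sign_neg hz] at h3
      rw [h3] at h2
      rw [h2] at h1
      rw [sign_eq_neg_one_iff] at h1 h2 h3
      exact ⟨-1, by linarith, by linarith, by linarith, by linarith⟩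
    · simp [hz] at h4
    · rw [sign_pos hz] at h3
      rw [h3] at h2
      rw [h2] at h1
      rw [sign_eq_one_iff] at h1 h2 h3
      exact ⟨1, by linarith, by linarith, by linarith, by linarith⟩
  · rintro ⟨τ, h1, h2, h3, h4⟩
    have key : ∀ u : ℝ, 0 < τ * u → SignType.sign u = SignType.sign τ := by
      intro u hu
      rcases pos_and_pos_or_neg_and_neg_of_mul_pos hu with ⟨h, h'⟩ | ⟨h, h'⟩
      · rw [sign_pos h, sign_pos h']
      · rw [sign_neg h, sign_neg h']
    rw [key w h1, key x h2, key y h3, key z h4]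
    refine ⟨rfl, rfl, rfl, ?_⟩
    rw [ne_eq, sign_eq_zero_iff]
    rintro rfl
    simp at h1

variable {N : ℕ}

/-- The reflexion condition through determinants. -/
lemma reflexion_iff {F : Chain N × Chain N} (h : ∀ j : Fin N, F.1 (mir j) ≠ F.2 (mir j)) :
    Reflexion F ↔ ∀ j : Fin N, ∃ τ : ℝ,
      0 < τ * det (F.1 (mir j) - F.2 (mir j)) (F.1 (pre j) - F.1 (mir j)) ∧
      0 < τ * det (F.1 (mir j) - F.2 (mir j)) (F.2 (pre j) - F.2 (mir j)) ∧
      0 < τ * det (F.1 (mir j) - F.2 (mir j)) (F.1 (nxt j) - F.1 (mir j)) ∧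
      0 < τ * det (F.1 (mir j) - F.2 (mir j)) (F.2 (nxt j) - F.2 (mir j)) := by
  refine forall_congr' fun j => ?_
  have hv := sub_ne_zero.2 (h j)
  simp only [mirrorNormal, sign_inner_unitNormal_angle hv]
  exact exists_mul_pos_iff

/-- One half comes from reflexion at the mirror `mir j`, the other from reflexion at the next
mirror. The bound on `j` excludes the last segment, which is a single point. -/
lemma facing_of_reflexion {F : Chain N × Chain N} (h : ∀ j : Fin N, F.1 (mir j) ≠ F.2 (mir j))
    (hR : Reflexion F) {j : Fin N} (hj : (j : ℕ) + 1 < N) :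
    Facing (F.1 (mir j)) (F.2 (mir j)) (F.1 (nxt j)) (F.2 (nxt j)) := by
  rw [reflexion_iff h] at hR
  obtain ⟨τ, -, -, h1, h2⟩ := hR j
  obtain ⟨τ', h3, h4, -, -⟩ := hR ⟨j + 1, hj⟩
  have e1 : mir (⟨j + 1, hj⟩ : Fin N) = nxt j := rfl
  have e2 : pre (⟨j + 1, hj⟩ : Fin N) = mir j := rfl
  rw [e1, e2] at h3 h4
  have key : ∀ τ x y : ℝ, 0 < τ * x → 0 < τ * y → 0 < x * y := by
    intro τ x y hx hy
    have h1 := mul_pos hx hy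
    have h2 : 0 < τ ^ 2 := by
      have := left_ne_zero_of_mul hx.ne'
      positivity
    refine pos_of_mul_pos_right (a := τ ^ 2) ?_ h2.le
    linarith
  constructor
  · convert key τ _ _ h1 h2 using 1
    simp only [det, PiLp.sub_apply]
    ring
  · convert key τ' _ _ h3 h4 using 1
    simp only [det, PiLp.sub_apply]
    ring

/-! ### Monotonicity and continuity of the impact parameters -/

lemma impactParam_succ (F : Chain N × Chain N) (t : ℝ) (j : Fin N) :
    impactParam F t j.succ = nextParam (F.1 (mir j)) (F.2 (mir j)) (F.1 (nxt j)) (F.2 (nxt j))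
      (impactParam F t j.castSucc) := rfl

lemma impactParam_succ_eq {F : Chain N × Chain N} (h : ∀ j : Fin N, F.1 (mir j) ≠ F.2 (mir j))
    (hR : Reflexion F) {t : ℝ} (ht : 0 ≤ t ∧ t ≤ 1) {j : Fin N} (hj : (j : ℕ) + 1 < N) :
    impactParam F t j.succ =
      homography (ratio (F.1 (mir j)) (F.2 (mir j)) (F.1 (nxt j)) (F.2 (nxt j)))
        (impactParam F t j.castSucc) := by
  rw [impactParam_succ, nextParam_eq (facing_of_reflexion h hR hj) (impactParam_mem F ht _)]

/-- A composition of increasing homographies is increasing. The index N is left out: the parameter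
of a point on the degenerate last segment carries no information. -/
lemma impactParam_lt {F : Chain N × Chain N} (h : ∀ j : Fin N, F.1 (mir j) ≠ F.2 (mir j))
    (hR : Reflexion F) {t t' : ℝ} (ht : 0 ≤ t ∧ t ≤ 1) (ht' : 0 ≤ t' ∧ t' ≤ 1) (htt' : t < t')
    (k : Fin (N + 1)) (hk : (k : ℕ) < N) : impactParam F t k < impactParam F t' k := by
  induction k using Fin.induction with
  | zero => exact htt'
  | succ j ih =>
    rw [Fin.val_succ] at hk
    rw [impactParam_succ_eq h hR ht hk, impactParam_succ_eq h hR ht' hk]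
    exact homography_lt (ratio_pos (facing_of_reflexion h hR hk)) (impactParam_mem F ht _)
      (impactParam_mem F ht' _) (ih j.2)

lemma impactParam_zero_time {F : Chain N × Chain N}
    (h : ∀ j : Fin N, F.1 (mir j) ≠ F.2 (mir j)) (hR : Reflexion F)
    (k : Fin (N + 1)) (hk : (k : ℕ) < N) : impactParam F 0 k = 0 := by
  induction k using Fin.induction with
  | zero => rfl
  | succ j ih =>
    rw [Fin.val_succ] at hk
    rw [impactParam_succ_eq h hR (by norm_num) hk, ih j.2]
    simp [homography]

lemma impactParam_one_time {F : Chain N × Chain N}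
    (h : ∀ j : Fin N, F.1 (mir j) ≠ F.2 (mir j)) (hR : Reflexion F)
    (k : Fin (N + 1)) (hk : (k : ℕ) < N) : impactParam F 1 k = 1 := by
  induction k using Fin.induction with
  | zero => rfl
  | succ j ih =>
    rw [Fin.val_succ] at hk
    rw [impactParam_succ_eq h hR (by norm_num) hk, ih j.2]
    simp [homography, (ratio_pos (facing_of_reflexion h hR hk)).ne']

lemma continuous_det : Continuous fun v : Plane × Plane => det v.1 v.2 := by
  unfold det
  fun_prop

lemma _root_.Continuous.plane_det {X : Type*} [TopologicalSpace X] {f g : X → Plane}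
    (hf : Continuous f) (hg : Continuous g) : Continuous fun x => OpticalBeam.det (f x) (g x) :=
  continuous_det.comp (hf.prodMk hg)

/-- The impact parameters depend continuously on the beam and on the time. -/
lemma continuous_impactParam {X : Type*} [TopologicalSpace X] {F : X → Chain N × Chain N}
    {t : X → ℝ} (hF : Continuous F) (ht : Continuous t)
    (h : ∀ x, ∀ j : Fin N, (F x).1 (mir j) ≠ (F x).2 (mir j)) (hR : ∀ x, Reflexion (F x))
    (ht' : ∀ x, 0 ≤ t x ∧ t x ≤ 1) (k : Fin (N + 1)) (hk : (k : ℕ) < N) :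
    Continuous fun x => impactParam (F x) (t x) k := by
  have c1 : ∀ i, Continuous fun x => (F x).1 i := fun i => (continuous_apply i).comp hF.fst
  have c2 : ∀ i, Continuous fun x => (F x).2 i := fun i => (continuous_apply i).comp hF.snd
  induction k using Fin.induction with
  | zero => exact ht
  | succ j ih =>
    rw [Fin.val_succ] at hk
    have e := fun x => impactParam_succ_eq (h x) (hR x) (ht' x) hk
    simp only [e]
    have ih := ih j.2
    have hf := fun x => facing_of_reflexion (h x) (hR x) hk
    have hr : Continuous fun x =>
        ratio ((F x).1 (mir j)) ((F x).2 (mir j)) ((F x).1 (nxt j)) ((F x).2 (nxt j)) := by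
      refine Continuous.div ?_ ?_ fun x => mul_ne_zero (right_ne_zero_of_mul (hf x).1.ne')
        (left_ne_zero_of_mul (hf x).2.ne')
      · exact (((c2 _).sub (c1 _)).plane_det ((c2 _).sub (c1 _))).mul
          (((c2 _).sub (c1 _)).plane_det ((c1 _).sub (c1 _)))
      · exact (((c2 _).sub (c1 _)).plane_det ((c2 _).sub (c1 _))).mul
          (((c2 _).sub (c1 _)).plane_det ((c1 _).sub (c1 _)))
    exact (ih.mul hr).div ((continuous_const.sub ih).add (ih.mul hr)) fun x =>
      (homography_denom_pos (ratio_pos (hf x)) (impactParam_mem _ (ht' x) _)).ne'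

lemma eq_last_of_not_lt {k : Fin (N + 1)} (hk : ¬ (k : ℕ) < N) : k.succ = Fin.last (N + 1) := by
  apply Fin.ext
  have := k.2
  simp only [Fin.val_succ, Fin.val_last]
  omega

lemma continuous_tChain {X : Type*} [TopologicalSpace X] {F : X → Chain N × Chain N}
    {t : X → ℝ} (hF : Continuous F) (ht : Continuous t)
    (hP : ∀ x, F x ∈ FaiscP N) (hR : ∀ x, Reflexion (F x))
    (ht' : ∀ x, 0 ≤ t x ∧ t x ≤ 1) : Continuous fun x => tChain (F x) (t x) := by
  have c1 : ∀ i, Continuous fun x => (F x).1 i := fun i => (continuous_apply i).comp hF.fst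
  have c2 : ∀ i, Continuous fun x => (F x).2 i := fun i => (continuous_apply i).comp hF.snd
  have cl : ∀ i, ∀ s : X → ℝ, Continuous s →
      Continuous fun x => AffineMap.lineMap ((F x).1 i) ((F x).2 i) (s x) := by
    intro i s hs
    simp only [AffineMap.lineMap_apply_module]
    exact ((continuous_const.sub hs).smul (c1 i)).add (hs.smul (c2 i))
  refine continuous_pi fun i => ?_
  induction i using Fin.cases with
  | zero =>
    simp only [tChain_zero]
    exact (cl _ _ ht).add (c1 0)
  | succ k =>
    simp only [tChain_succ]
    by_cases hk : (k : ℕ) < N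
    · exact cl _ _ (continuous_impactParam hF ht (fun x => (hP x).1) hR ht' k hk)
    -- The last parameter is not controlled, but both ends of the last segment coincide, so it has
    -- no effect on the vertex.
    · rw [eq_last_of_not_lt hk]
      have e : ∀ x, (F x).1 (Fin.last (N + 1)) = (F x).2 (Fin.last (N + 1)) :=
        fun x => (hP x).2.2.2.1
      simpa only [← e, AffineMap.lineMap_same_apply] using c1 _

/-! ### Parts of a beam between two of its chains -/

lemma lineMap_lineMap_lineMap (p q : Plane) (l m u : ℝ) :
    AffineMap.lineMap (AffineMap.lineMap p q l) (AffineMap.lineMap p q m) u =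
      AffineMap.lineMap p q (AffineMap.lineMap l m u) := by
  rw [Plane.ext_iff]
  simp only [AffineMap.lineMap_apply_module, smul_eq_mul, PiLp.add_apply, PiLp.smul_apply]
  constructor <;> ring

lemma det_lineMap_sub (p q x y : Plane) (l m s r : ℝ) :
    det (AffineMap.lineMap p q m - AffineMap.lineMap p q l)
      (AffineMap.lineMap x y s - AffineMap.lineMap p q r) =
      (m - l) * ((1 - s) * det (q - p) (x - p) + s * det (q - p) (y - p)) := by
  simp only [det, PiLp.sub_apply, lineMap_coord]
  ring

lemma convex_combination_ne_zero {x y s : ℝ} (hxy : 0 < x * y) (hs : 0 ≤ s ∧ s ≤ 1) :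
    (1 - s) * x + s * y ≠ 0 := by
  intro h
  have hx : 0 < x ^ 2 := by
    have := left_ne_zero_of_mul hxy.ne'
    positivity
  have h1 : (1 - s) * x ^ 2 + s * (x * y) = 0 := by linear_combination x * h
  have h2 := mul_nonneg (sub_nonneg.2 hs.2) hx.le
  have h3 := mul_nonneg hs.1 hxy.le
  have h4 : s * (x * y) = 0 := by linarith
  have h5 : s = 0 := (mul_eq_zero.1 h4).resolve_right hxy.ne'
  rw [h5] at h1
  linarith

/-- The coefficient of the homography between corresponding subsegments. -/
lemma ratio_lineMap {p q p' q' : Plane} (h : Facing p q p' q') {l m : ℝ}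
    (hl : 0 ≤ l ∧ l ≤ 1) (hm : 0 ≤ m ∧ m ≤ 1) (hlm : l < m) :
    ratio (AffineMap.lineMap p q l) (AffineMap.lineMap p q m)
      (AffineMap.lineMap p' q' (homography (ratio p q p' q') l))
      (AffineMap.lineMap p' q' (homography (ratio p q p' q') m)) =
      (1 - m + m * ratio p q p' q') / (1 - l + l * ratio p q p' q') := by
  have hr := ratio_pos h
  have hl' := homography_mem hr hl
  have hm' := homography_mem hr hm
  have hlm' := homography_lt hr hl hm hlm
  have dl := (homography_denom_pos hr hl).ne'
  have dm := (homography_denom_pos hr hm).ne'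
  rw [ratio]
  simp only [det_lineMap_sub]
  -- Up to constants, the determinant measuring the impact point against the line (pq) equals the
  -- one measuring the starting point against the line (p'q'), divided by the denominator of the
  -- homography. In the ratio for the subsegments everything but the two denominators cancels.
  have key : ∀ s : ℝ, 0 ≤ s ∧ s ≤ 1 →
      (1 - homography (ratio p q p' q') s) * det (q - p) (p' - p) +
        homography (ratio p q p' q') s * det (q - p) (q' - p) =
      det (q - p) (p' - p) *
        ((1 - s) * det (q' - p') (p - p') + s * det (q' - p') (q - p')) /
        (det (q' - p') (p - p') * (1 - s + s * ratio p q p' q')) := by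
    intro s hs
    have ds := (homography_denom_pos hr hs).ne'
    have h1 := left_ne_zero_of_mul h.2.ne'
    have e : ratio p q p' q' * (det (q - p) (q' - p) * det (q' - p') (p - p')) =
        det (q' - p') (q - p') * det (q - p) (p' - p) := by
      rw [ratio, div_mul_cancel₀ _ (mul_ne_zero (right_ne_zero_of_mul h.1.ne') h1)]
    rw [eq_div_iff (mul_ne_zero h1 ds), homography]
    set r := ratio p q p' q'
    have e2 : (1 - s * r / (1 - s + s * r)) * (1 - s + s * r) = 1 - s := by
      rw [sub_mul, div_mul_cancel₀ _ ds]; ring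
    have e3 : s * r / (1 - s + s * r) * (1 - s + s * r) = s * r := div_mul_cancel₀ _ ds
    linear_combination det (q - p) (p' - p) * det (q' - p') (p - p') * e2 +
      det (q - p) (q' - p) * det (q' - p') (p - p') * e3 + s * e
  rw [key l hl, key m hm]
  have n1 := left_ne_zero_of_mul h.1.ne'
  have n2 := left_ne_zero_of_mul h.2.ne'
  have n3 := convex_combination_ne_zero h.2 hl
  have n4 := convex_combination_ne_zero h.2 hm
  have n5 := (sub_pos.2 hlm).ne'
  have n6 := (sub_pos.2 hlm').ne'
  set Hl := (1 - l) * det (q' - p') (p - p') + l * det (q' - p') (q - p')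
  set Hm := (1 - m) * det (q' - p') (p - p') + m * det (q' - p') (q - p')
  set G := det (q - p) (p' - p)
  set H := det (q' - p') (p - p')
  set Dl := 1 - l + l * ratio p q p' q'
  set Dm := 1 - m + m * ratio p q p' q'
  set x := homography (ratio p q p' q') m - homography (ratio p q p' q') l
  set y := m - l
  clear_value Hl Hm G H Dl Dm x y
  field_simp

/-- The part of a beam between the `t₁`-chain and the `t₂`-chain. -/
noncomputable def subBeam (F : Chain N × Chain N) (t₁ t₂ : ℝ) : Chain N × Chain N :=
  -- The vertices of index 0 are those of F, not those of the t-chains, since a primary beam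
  -- requires them to be (-1, 0).
  (Fin.cons (F.1 0) fun k => tChain F t₁ k.succ, Fin.cons (F.2 0) fun k => tChain F t₂ k.succ)

lemma subBeam_fst_succ (F : Chain N × Chain N) (t₁ t₂ : ℝ) (k : Fin (N + 1)) :
    (subBeam F t₁ t₂).1 k.succ =
      AffineMap.lineMap (F.1 k.succ) (F.2 k.succ) (impactParam F t₁ k) := rfl

lemma subBeam_snd_succ (F : Chain N × Chain N) (t₁ t₂ : ℝ) (k : Fin (N + 1)) :
    (subBeam F t₁ t₂).2 k.succ =
      AffineMap.lineMap (F.1 k.succ) (F.2 k.succ) (impactParam F t₂ k) := rfl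

lemma subBeam_sub {F : Chain N × Chain N} (t₁ t₂ : ℝ) (k : Fin (N + 1)) :
    (subBeam F t₁ t₂).1 k.succ - (subBeam F t₁ t₂).2 k.succ =
      (impactParam F t₂ k - impactParam F t₁ k) • (F.1 k.succ - F.2 k.succ) := by
  rw [subBeam_fst_succ, subBeam_snd_succ, lineMap_sub_lineMap_self]

section

variable {F : Chain N × Chain N} (hF : F ∈ Faisc N) {t₁ t₂ : ℝ} (h₁ : 0 ≤ t₁ ∧ t₁ ≤ 1)
  (h₂ : 0 ≤ t₂ ∧ t₂ ≤ 1) (h₁₂ : t₁ < t₂)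

include hF h₁ h₂

lemma exists_subBeam_eq (k : Fin (N + 2)) : ∃ l m : ℝ, (0 ≤ l ∧ l ≤ 1) ∧ (0 ≤ m ∧ m ≤ 1) ∧
    (subBeam F t₁ t₂).1 k = AffineMap.lineMap (F.1 k) (F.2 k) l ∧
    (subBeam F t₁ t₂).2 k = AffineMap.lineMap (F.1 k) (F.2 k) m := by
  induction k using Fin.cases with
  | zero =>
    refine ⟨0, 0, by norm_num, by norm_num, by simp [subBeam], ?_⟩
    rw [AffineMap.lineMap_apply_zero, hF.1.2.1, ← hF.1.2.2.1]
    rfl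
  | succ k => exact ⟨_, _, impactParam_mem F h₁ k, impactParam_mem F h₂ k, rfl, rfl⟩

include h₁₂

/-- Symmetry of the two times about 1/2 is what keeps the midpoint of the first mirror at the
origin. -/
lemma subBeam_mem_FaiscP (h : t₁ + t₂ = 1) : subBeam F t₁ t₂ ∈ FaiscP N := by
  refine ⟨fun j => ?_, hF.1.2.1, hF.1.2.2.1, ?_, ?_⟩
  · rw [← sub_ne_zero, subBeam_sub]
    exact smul_ne_zero (sub_pos.2 (impactParam_lt hF.1.1 hF.2.2 h₁ h₂ h₁₂ _ j.2)).ne'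
      (sub_ne_zero.2 (hF.1.1 j))
  · rw [← Fin.succ_last, subBeam_fst_succ, subBeam_snd_succ, Fin.succ_last, ← hF.1.2.2.2.1]
    simp
  · have e := hF.1.2.2.2.2
    have e1 : (subBeam F t₁ t₂).1 1 = AffineMap.lineMap (F.1 1) (F.2 1) t₁ := rfl
    have e2 : (subBeam F t₁ t₂).2 1 = AffineMap.lineMap (F.1 1) (F.2 1) t₂ := rfl
    rw [e1, e2, midpoint, lineMap_lineMap_lineMap, ← e, midpoint]
    congr 1
    simp only [AffineMap.lineMap_apply_module, smul_eq_mul, invOf_eq_inv]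
    linarith

lemma subBeam_reflexion : Reflexion (subBeam F t₁ t₂) := by
  have hne : ∀ j : Fin N, (subBeam F t₁ t₂).1 (mir j) ≠ (subBeam F t₁ t₂).2 (mir j) := by
    intro j
    rw [← sub_ne_zero, subBeam_sub]
    exact smul_ne_zero (sub_pos.2 (impactParam_lt hF.1.1 hF.2.2 h₁ h₂ h₁₂ _ j.2)).ne'
      (sub_ne_zero.2 (hF.1.1 j))
  rw [reflexion_iff hne]
  intro j
  obtain ⟨τ, r1, r2, r3, r4⟩ := (reflexion_iff hF.1.1).1 hF.2.2 j
  have hlt := sub_pos.2 (impactParam_lt hF.1.1 hF.2.2 h₁ h₂ h₁₂ j.castSucc j.2)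
  have key : ∀ (x y : Plane) (l m : ℝ), 0 ≤ l ∧ l ≤ 1 →
      0 < τ * det (F.1 (mir j) - F.2 (mir j)) (x - F.1 (mir j)) →
      0 < τ * det (F.1 (mir j) - F.2 (mir j)) (y - F.2 (mir j)) →
      0 < τ * det ((subBeam F t₁ t₂).1 (mir j) - (subBeam F t₁ t₂).2 (mir j))
        (AffineMap.lineMap x y l - AffineMap.lineMap (F.1 (mir j)) (F.2 (mir j)) m) := by
    intro x y l m hl hx hy
    rw [subBeam_sub, det_smul_left, det_lineMap_sub_lineMap]
    have h1 : SignType.sign _ = 1 := sign_convex hl one_ne_zero (sign_pos hx) (sign_pos hy)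
    rw [sign_eq_one_iff] at h1
    calc 0 < _ := mul_pos hlt h1
      _ = _ := by ring
  obtain ⟨l, m, hl, hm, e1, e2⟩ := exists_subBeam_eq hF h₁ h₂ (pre j)
  obtain ⟨l', m', hl', hm', e1', e2'⟩ := exists_subBeam_eq hF h₁ h₂ (nxt j)
  refine ⟨τ, ?_, ?_, ?_, ?_⟩
  · rw [e1]; exact key _ _ _ _ hl r1 r2
  · rw [e2]; exact key _ _ _ _ hm r1 r2
  · rw [e1']; exact key _ _ _ _ hl' r3 r4
  · rw [e2']; exact key _ _ _ _ hm' r3 r4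

/-- The coefficient found in `homography_lineMap` is the geometric one of `ratio_lineMap`; so
rescaling the parameters commutes with propagation, one mirror after the other. -/
lemma impactParam_subBeam {u : ℝ} (hu : 0 ≤ u ∧ u ≤ 1) (k : Fin (N + 1)) (hk : (k : ℕ) < N) :
    impactParam F (AffineMap.lineMap t₁ t₂ u) k =
      AffineMap.lineMap (impactParam F t₁ k) (impactParam F t₂ k)
        (impactParam (subBeam F t₁ t₂) u k) := by
  have ht : 0 ≤ AffineMap.lineMap t₁ t₂ u ∧ AffineMap.lineMap t₁ t₂ u ≤ 1 := by
    simp only [AffineMap.lineMap_apply_module, smul_eq_mul]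
    constructor <;> nlinarith
  have hne : ∀ j : Fin N, (subBeam F t₁ t₂).1 (mir j) ≠ (subBeam F t₁ t₂).2 (mir j) := by
    intro j
    rw [← sub_ne_zero, subBeam_sub]
    exact smul_ne_zero (sub_pos.2 (impactParam_lt hF.1.1 hF.2.2 h₁ h₂ h₁₂ _ j.2)).ne'
      (sub_ne_zero.2 (hF.1.1 j))
  induction k using Fin.induction with
  | zero => rfl
  | succ j ih =>
    rw [Fin.val_succ] at hk
    have hf := facing_of_reflexion hF.1.1 hF.2.2 hk
    rw [impactParam_succ_eq hF.1.1 hF.2.2 ht hk, ih j.2,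
      homography_lineMap (ratio_pos hf) (impactParam_mem F h₁ _) (impactParam_mem F h₂ _)
        (impactParam_mem _ hu _),
      impactParam_succ_eq hne (subBeam_reflexion hF h₁ h₂ h₁₂) hu hk,
      ← ratio_lineMap hf (impactParam_mem F h₁ _) (impactParam_mem F h₂ _)
        (impactParam_lt hF.1.1 hF.2.2 h₁ h₂ h₁₂ _ j.2),
      ← impactParam_succ_eq hF.1.1 hF.2.2 h₁ hk, ← impactParam_succ_eq hF.1.1 hF.2.2 h₂ hk]
    rfl

/-- The chains of a part of a beam are chains of the beam. -/
lemma tChain_subBeam {u : ℝ} (hu : 0 ≤ u ∧ u ≤ 1) :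
    tChain (subBeam F t₁ t₂) u = tChain F (AffineMap.lineMap t₁ t₂ u) := by
  ext1 i
  induction i using Fin.cases with
  | zero =>
    rw [tChain_zero, tChain_zero]
    congr 1
    exact lineMap_lineMap_lineMap _ _ _ _ _
  | succ k =>
    rw [tChain_succ, tChain_succ, subBeam_fst_succ, subBeam_snd_succ, lineMap_lineMap_lineMap]
    by_cases hk : (k : ℕ) < N
    · rw [impactParam_subBeam hF h₁ h₂ h₁₂ hu k hk]
    · rw [eq_last_of_not_lt hk, ← hF.1.2.2.2.1]
      simp

/-- Non-obscuration is inherited because the rays are rays of chains of F and the mirrors are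
subsegments of those of F. -/
lemma subBeam_mem_Faisc (h : t₁ + t₂ = 1) : subBeam F t₁ t₂ ∈ Faisc N := by
  refine ⟨subBeam_mem_FaiscP hF h₁ h₂ h₁₂ h, ?_, subBeam_reflexion hF h₁ h₂ h₁₂⟩
  intro j u hu0 hu1 k hk0 hk1 hk2
  have ht : 0 ≤ AffineMap.lineMap t₁ t₂ u ∧ AffineMap.lineMap t₁ t₂ u ≤ 1 := by
    simp only [AffineMap.lineMap_apply_module, smul_eq_mul]
    constructor <;> nlinarith
  rw [tChain_subBeam hF h₁ h₂ h₁₂ ⟨hu0, hu1⟩, Set.eq_empty_iff_forall_notMem]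
  rintro x ⟨hx1, hx2⟩
  refine Set.eq_empty_iff_forall_notMem.1 (hF.2.1 j _ ht.1 ht.2 k hk0 hk1 hk2) x ⟨hx1, ?_⟩
  have hs : ∀ {t : ℝ}, 0 ≤ t ∧ t ≤ 1 → tChain F t k ∈ segment ℝ (F.1 k) (F.2 k) :=
    fun ht => tChain_mem_segment F ht k hk0
  obtain ⟨k, rfl⟩ := Fin.exists_succ_eq.2 hk0
  exact (convex_segment (F.1 k.succ) (F.2 k.succ)).segment_subset (hs h₁) (hs h₂) hx2

end

lemma subBeam_zero_one {F : Chain N × Chain N} (hF : F ∈ Faisc N) : subBeam F 0 1 = F := by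
  refine Prod.ext ?_ ?_ <;> ext1 i <;> induction i using Fin.cases with
  | zero => rfl
  | succ k =>
    first | rw [subBeam_fst_succ] | rw [subBeam_snd_succ]
    by_cases hk : (k : ℕ) < N
    · first
      | rw [impactParam_zero_time hF.1.1 hF.2.2 k hk, AffineMap.lineMap_apply_zero]
      | rw [impactParam_one_time hF.1.1 hF.2.2 k hk, AffineMap.lineMap_apply_one]
    · rw [eq_last_of_not_lt hk, ← hF.1.2.2.2.1]
      simp

/-- A beam is joined to its part around the centered chain. -/
lemma joined_subBeam {F : Chain N × Chain N} (hF : F ∈ Faisc N) {ε : ℝ} (hε : 0 < ε)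
    (hε' : ε ≤ 1 / 2) : JoinedIn (Faisc N) F (subBeam F (1 / 2 - ε) (1 / 2 + ε)) := by
  have hc : ∀ t : unitInterval → ℝ, Continuous t → (∀ x, 0 ≤ t x ∧ t x ≤ 1) →
      Continuous fun x => tChain F (t x) := fun t ht ht' =>
    continuous_tChain (F := fun _ => F) continuous_const ht (fun _ => hF.1) (fun _ => hF.2.2) ht'
  let e : unitInterval → ℝ := fun x => (1 - (x : ℝ)) * (1 / 2) + x * ε
  have he : Continuous e := by fun_prop
  have he' : ∀ x, 0 < e x ∧ e x ≤ 1 / 2 := by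
    intro x
    have h0 := x.2.1
    have h1 := x.2.2
    simp only [e]
    constructor <;> nlinarith
  have m1 : ∀ x, 0 ≤ 1 / 2 - e x ∧ 1 / 2 - e x ≤ 1 := fun x =>
    ⟨by linarith [he' x], by linarith [he' x]⟩
  have m2 : ∀ x, 0 ≤ 1 / 2 + e x ∧ 1 / 2 + e x ≤ 1 := fun x =>
    ⟨by linarith [he' x], by linarith [he' x]⟩
  have c1 : Continuous fun x => tChain F (1 / 2 - e x) := hc _ (continuous_const.sub he) m1
  have c2 : Continuous fun x => tChain F (1 / 2 + e x) := hc _ (continuous_const.add he) m2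
  refine ⟨⟨⟨fun x => subBeam F (1 / 2 - e x) (1 / 2 + e x), ?_⟩, ?_, ?_⟩, fun x => ?_⟩
  · refine Continuous.prodMk (continuous_pi fun i => ?_) (continuous_pi fun i => ?_)
    · induction i using Fin.cases with
      | zero => exact continuous_const
      | succ k => exact continuous_pi_iff.1 c1 k.succ
    · induction i using Fin.cases with
      | zero => exact continuous_const
      | succ k => exact continuous_pi_iff.1 c2 k.succ
  · have : e 0 = 1 / 2 := by simp [e]
    simp only [this, sub_self, add_halves, subBeam_zero_one hF]
  · have : e 1 = ε := by simp [e]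
    simp only [this]
  · exact subBeam_mem_Faisc hF (m1 x) (m2 x) (by linarith [he' x]) (by ring)

/-! ### Openness and affine invariance of the space of chains -/

lemma ray_eq_empty_iff (c : Chain N) (j : Fin (N + 1)) : ray c j = ∅ ↔ j = 0 ∧ c 0 = c 1 := by
  unfold ray halfLine
  split_ifs with h h'
  · simp [h, h']
  · simp only [h, h', and_false, iff_false]
    intro he
    exact Set.eq_empty_iff_forall_notMem.1 he (c 1) ⟨0, le_rfl, by simp⟩
  · simp only [h, false_and, iff_false]
    intro he
    exact Set.eq_empty_iff_forall_notMem.1 he _ (left_mem_segment ℝ _ _)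

/-- The equality case of Cauchy–Schwarz turns membership into an equation between continuous
functions. -/
lemma mem_halfLine_iff {x y z : Plane} (h : x ≠ y) :
    z ∈ halfLine x y ↔ inner ℝ (z - y) (x - y) = ‖z - y‖ * ‖x - y‖ := by
  rw [halfLine, if_neg h]
  have hn : 0 < ‖x - y‖ := norm_pos_iff.2 (sub_ne_zero.2 h)
  constructor
  · rintro ⟨s, hs, rfl⟩
    rw [add_sub_cancel_left, real_inner_smul_left, real_inner_self_eq_norm_mul_norm, norm_smul,
      Real.norm_of_nonneg hs, mul_assoc]
  · intro he
    rw [inner_eq_norm_mul_iff_real] at he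
    refine ⟨‖z - y‖ / ‖x - y‖, by positivity, ?_⟩
    rw [div_eq_inv_mul, mul_smul, ← he, smul_smul, inv_mul_cancel₀ hn.ne', one_smul,
      add_sub_cancel]

lemma mem_LO_iff {c : Chain N} : c ∈ LO N ↔
    c 0 ≠ c 1 ∧ (∀ j : Fin (N + 1), ∀ k : Fin (N + 2), k ≠ 0 → k ≠ j.castSucc → k ≠ j.succ →
      c k ∉ ray c j) ∧ ∀ j : Fin N, c (mir j) ∉ segment ℝ (c (pre j)) (c (nxt j)) := by
  simp only [LO, Set.mem_ofPred_eq, Obsc, Graz, ray_eq_empty_iff, not_or, not_exists, not_and]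
  constructor
  · rintro ⟨h1, h2⟩
    exact ⟨(h1 0).1 rfl, fun j k a b d => (h1 j).2 k a b d, h2⟩
  · rintro ⟨h1, h2, h3⟩
    exact ⟨fun j => ⟨fun _ => h1, h2 j⟩, h3⟩

/-- Membership in a segment is equality in the triangle inequality, a closed condition. -/
lemma isOpen_notMem_segment {X : Type*} [TopologicalSpace X] {f g h : X → Plane}
    (hf : Continuous f) (hg : Continuous g) (hh : Continuous h) :
    IsOpen {x | f x ∉ segment ℝ (g x) (h x)} := by
  simp only [mem_segment_iff_wbtw, ← dist_add_dist_eq_iff]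
  exact isOpen_ne_fun ((hg.dist hf).add (hf.dist hh)) (hg.dist hh)

lemma isOpen_LO : IsOpen (LO N) := by
  have c : ∀ k, Continuous fun c : Chain N => c k := continuous_apply
  have e : LO N = {c | c 0 ≠ c 1} ∩ ((⋂ j : Fin (N + 1), ⋂ k : Fin (N + 2),
      {c : Chain N | k ≠ 0 → k ≠ j.castSucc → k ≠ j.succ →
        if j = 0 then inner ℝ (c k - c 1) (c 0 - c 1) ≠ ‖c k - c 1‖ * ‖c 0 - c 1‖
        else c k ∉ segment ℝ (c j.castSucc) (c j.succ)}) ∩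
      ⋂ j : Fin N, {c : Chain N | c (mir j) ∉ segment ℝ (c (pre j)) (c (nxt j))}) := by
    ext c
    rw [mem_LO_iff]
    simp only [Set.mem_inter_iff, Set.mem_iInter, Set.mem_ofPred_eq]
    refine and_congr_right fun h => and_congr_left fun _ => ?_
    refine forall₂_congr fun j k => imp_congr_right fun _ => imp_congr_right fun _ =>
      imp_congr_right fun _ => ?_
    unfold ray
    split_ifs with hj
    · rw [mem_halfLine_iff h]
    · rfl
  rw [e]
  refine (isOpen_ne_fun (c 0) (c 1)).inter (IsOpen.inter ?_ ?_)
  · refine isOpen_iInter_of_finite fun j => isOpen_iInter_of_finite fun k => ?_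
    by_cases h : k ≠ 0 ∧ k ≠ j.castSucc ∧ k ≠ j.succ
    · simp only [h, ne_eq, not_false_eq_true, forall_const]
      by_cases hj : j = 0
      · simp only [hj, if_true]
        exact isOpen_ne_fun (((c k).sub (c 1)).inner ((c 0).sub (c 1)))
          (((c k).sub (c 1)).norm.mul ((c 0).sub (c 1)).norm)
      · simp only [hj, if_false]
        exact isOpen_notMem_segment (c _) (c _) (c _)
    · convert isOpen_univ
      ext c
      simp only [Set.mem_ofPred_eq, Set.mem_univ, iff_true]
      intro a b d
      exact absurd ⟨a, b, d⟩ h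
  · exact isOpen_iInter_of_finite fun j => isOpen_notMem_segment (c _) (c _) (c _)

lemma ne_pre_of_mem_LO {c : Chain N} (hc : c ∈ LO N) (j : Fin N) : c (mir j) ≠ c (pre j) :=
  fun h => (mem_LO_iff.1 hc).2.2 j (h ▸ left_mem_segment ℝ _ _)

lemma ne_nxt_of_mem_LO {c : Chain N} (hc : c ∈ LO N) (j : Fin N) : c (mir j) ≠ c (nxt j) :=
  fun h => (mem_LO_iff.1 hc).2.2 j (h ▸ right_mem_segment ℝ _ _)

/-- Injective affine maps preserve the chains without obscuration and grazing. -/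
lemma map_mem_LO {f : Plane →ᵃ[ℝ] Plane} (hf : Function.Injective f) {c : Chain N}
    (hc : c ∈ LO N) : (fun i => f (c i)) ∈ LO N := by
  rw [mem_LO_iff] at hc ⊢
  have hs : ∀ x y z, f z ∈ segment ℝ (f x) (f y) → z ∈ segment ℝ x y := by
    intro x y z h
    rw [← image_segment] at h
    exact (hf.mem_set_image).1 h
  have hl : ∀ x y z, f z ∈ halfLine (f x) (f y) → z ∈ halfLine x y := by
    intro x y z h
    unfold halfLine at h ⊢
    by_cases hxy : x = y
    · simp [hxy] at h
    · rw [if_neg (hf.ne hxy)] at h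
      rw [if_neg hxy]
      obtain ⟨s, hs, h⟩ := h
      refine ⟨s, hs, hf ?_⟩
      have := f.apply_lineMap y x s
      rw [AffineMap.lineMap_apply, AffineMap.lineMap_apply] at this
      simp only [vsub_eq_sub, vadd_eq_add] at this
      rw [h, add_comm, ← this, add_comm]
  refine ⟨hf.ne hc.1, fun j k a b d h => hc.2.1 j k a b d ?_, fun j h => hc.2.2 j (hs _ _ _ h)⟩
  unfold ray at h ⊢
  split_ifs at h ⊢
  · exact hl _ _ _ h
  · exact hs _ _ _ h

/-! ### Chains with mirror directions of given characteristic -/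

/-- The sign that the orientation of a mirror has for a given characteristic. -/
def orient (χ : Fin N → ℤˣ) (j : Fin N) : ℝ := ((χ j : ℤ) : ℝ) * (-1) ^ ((j : ℕ) + 1)

/-- The chains of `LO^N(ℝ²)` with nonzero vectors directing the mirrors, of characteristic `χ`. -/
def Adm (χ : Fin N → ℤˣ) : Set (Chain N × Chain N) :=
  {x | x.1 ∈ LO N ∧ ∀ j : Fin N,
    0 < orient χ j * det (x.1 (mir j) - x.1 (pre j)) (x.2 (mir j)) ∧
    0 < orient χ j * det (x.1 (mir j) - x.1 (nxt j)) (x.2 (mir j))}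

lemma isOpen_Adm (χ : Fin N → ℤˣ) : IsOpen (Adm χ) := by
  have c1 : ∀ k, Continuous fun c : Chain N × Chain N => c.1 k :=
    fun k => (continuous_apply k).comp continuous_fst
  have c2 : ∀ k, Continuous fun c : Chain N × Chain N => c.2 k :=
    fun k => (continuous_apply k).comp continuous_snd
  have e : Adm χ = Prod.fst ⁻¹' (LO N) ∩ ⋂ j : Fin N,
      ({x : Chain N × Chain N |
        0 < orient χ j * det (x.1 (mir j) - x.1 (pre j)) (x.2 (mir j))} ∩
      {x : Chain N × Chain N |
        0 < orient χ j * det (x.1 (mir j) - x.1 (nxt j)) (x.2 (mir j))}) := by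
    ext x
    simp [Adm]
  rw [e]
  refine (isOpen_LO.preimage continuous_fst).inter (isOpen_iInter_of_finite fun j => ?_)
  exact (isOpen_lt continuous_const
    (continuous_const.mul (((c1 _).sub (c1 _)).plane_det (c2 _)))).inter
    (isOpen_lt continuous_const (continuous_const.mul (((c1 _).sub (c1 _)).plane_det (c2 _))))

lemma angle_mem_halfCircle_iff {v e : Plane} (hv : v ≠ 0) (he : e ≠ 0) {s : ℤ}
    (hs : s = 1 ∨ s = -1) : angle e ∈ halfCircle (angle v) s ↔ 0 < (s : ℝ) * det v e := by
  obtain ⟨r, -, hr, h0, h1⟩ := exists_polar v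
  obtain ⟨r', -, hr', h0', h1'⟩ := exists_polar e
  have : (s : ℝ) * det v e = r * r' * (s * (angle e - angle v).sin) := by
    rw [det, h0, h1, h0', h1', sub_eq_add_neg (angle e), Real.Angle.sin_add, Real.Angle.sin_neg,
      Real.Angle.cos_neg]
    ring
  rw [mem_halfCircle hs, this, mul_pos_iff_of_pos_left (mul_pos (hr hv) (hr' he))]

/-- The characteristic of a beam through determinants. -/
lemma carF_eq_iff (F : Faisc N) (χ : Fin N → ℤˣ) :
    carF F = χ ↔ (tChain F.1 (1 / 2), F.1.1 - F.1.2) ∈ Adm χ := by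
  have hc := tChain_mem_LO F.2 half_mem
  have : (tChain F.1 (1 / 2), F.1.1 - F.1.2) ∈ Adm χ ↔ ∀ j : Fin N,
      0 < orient χ j * det (tChain F.1 (1 / 2) (mir j) - tChain F.1 (1 / 2) (pre j))
        (F.1.1 (mir j) - F.1.2 (mir j)) ∧
      0 < orient χ j * det (tChain F.1 (1 / 2) (mir j) - tChain F.1 (1 / 2) (nxt j))
        (F.1.1 (mir j) - F.1.2 (mir j)) := by
    simp only [Adm, Set.mem_ofPred_eq, hc, true_and]
    rfl
  rw [this, funext_iff]
  refine forall_congr' fun j => ?_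
  have h1 := sub_ne_zero.2 (ne_pre_of_mem_LO hc j)
  have h2 := sub_ne_zero.2 (ne_nxt_of_mem_LO hc j)
  have h3 := sub_ne_zero.2 (F.2.1.1 j)
  have hp := neg_one_pow_eq_or ℤ ((j : ℕ) + 1)
  have hp' := neg_one_pow_eq_or ℤ ((j : ℕ) + 2)
  rcases Int.units_eq_one_or (χ j) with h | h <;> unfold carF orient <;> rw [h]
  · rw [car_eq_one_iff]
    refine (and_congr (angle_mem_halfCircle_iff h1 h3 hp)
      (angle_mem_halfCircle_iff h2 h3 hp)).trans ?_
    simp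
  · rw [car_eq_neg_one_iff]
    refine (and_congr (angle_mem_halfCircle_iff h1 h3 hp')
      (angle_mem_halfCircle_iff h2 h3 hp')).trans ?_
    simp [pow_succ]

/-- Admissibility sees only the half-lines of the directions, and only at mirrors. This allows a
fixed `e` to stand for all mirror widths. -/
lemma Adm.smul {χ : Fin N → ℤˣ} {c e e' : Chain N} (h : (c, e) ∈ Adm χ)
    (he : ∀ j : Fin N, ∃ k : ℝ, 0 < k ∧ e' (mir j) = k • e (mir j)) : (c, e') ∈ Adm χ := by
  refine ⟨h.1, fun j => ?_⟩
  obtain ⟨k, hk, e⟩ := he j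
  obtain ⟨h1, h2⟩ := h.2 j
  have key : ∀ x y : Plane, det x (k • y) = k * det x y := by
    intro x y
    simp [det]
    ring
  simp only [e, key, mul_left_comm _ k]
  exact ⟨mul_pos hk h1, mul_pos hk h2⟩

lemma ray_congr {c d : Chain N} {j : Fin (N + 1)} (h0 : j = 0 → c 0 = d 0)
    (h1 : c j.castSucc = d j.castSucc) (h2 : c j.succ = d j.succ) : ray c j = ray d j := by
  unfold ray
  split_ifs with hj
  · subst hj
    rw [h0 rfl]
    congr 1
  · rw [h1, h2]

/-! ### Thin beams around a chain -/

/-- A primary beam is a beam if all chains with impact points on its mirrors are admissible. -/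
lemma mem_Faisc_of_thin {F : Chain N × Chain N} {e : Chain N} {χ : Fin N → ℤˣ}
    (hF : F ∈ FaiscP N)
    (he : ∀ j : Fin N, ∃ k : ℝ, 0 < k ∧ F.1 (mir j) - F.2 (mir j) = k • e (mir j))
    (h : ∀ d : Chain N, (∀ i, i ≠ 0 → d i ∈ segment ℝ (F.1 i) (F.2 i)) →
      d 0 - F.1 0 ∈ segment ℝ (F.1 1) (F.2 1) → (d, e) ∈ Adm χ) : F ∈ Faisc N := by
  refine ⟨hF, ?_, ?_⟩
  · intro j t ht0 ht1 k hk0 hk1 hk2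
    rw [Set.eq_empty_iff_forall_notMem]
    rintro y ⟨hy1, hy2⟩
    -- Moving the k-th vertex of the t-chain to the supposed obscuration point gives a chain allowed
    -- in `h` whose ray contains its own k-th vertex, against `LO N`.
    have hd := h (Function.update (tChain F t) k y) ?_ ?_
    · have := (mem_LO_iff.1 hd.1).2.1 j k hk0 hk1 hk2
      apply this
      dsimp only
      rw [Function.update_self]
      rwa [ray_congr (d := tChain F t)]
      · exact fun _ => Function.update_of_ne hk0.symm _ _
      · exact Function.update_of_ne hk1.symm _ _
      · exact Function.update_of_ne hk2.symm _ _
    · intro i hi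
      by_cases hik : i = k
      · subst hik
        rwa [Function.update_self]
      · rw [Function.update_of_ne hik]
        exact tChain_mem_segment F ⟨ht0, ht1⟩ i hi
    · rw [Function.update_of_ne hk0.symm, tChain_zero, add_sub_cancel_right, ← tChain_one]
      exact tChain_mem_segment F ⟨ht0, ht1⟩ 1 one_ne_zero
  · have key : ∀ x : Chain N, (∀ i, x i ∈ segment ℝ (F.1 i) (F.2 i)) → x 0 = F.1 0 →
        (∀ j : Fin N, pre j = 0 → det (x 1) (e (mir j)) = 0) → ∀ j : Fin N,
        0 < orient χ j * det (F.1 (mir j) - F.2 (mir j)) (x (pre j) - x (mir j)) ∧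
        0 < orient χ j * det (F.1 (mir j) - F.2 (mir j)) (x (nxt j) - x (mir j)) := by
      intro x hx hx0 hx1 j
      have hd := h (Function.update x 0 (x 1 + x 0)) ?_ ?_
      · obtain ⟨h1, h2⟩ := hd.2 j
        obtain ⟨k, hk, hke⟩ := he j
        have e1 : ∀ y z : Plane, det (k • y) z = k * -det z y := by
          intro y z
          simp [det]
          ring
        have e2 : ∀ y z w : Plane, -det (y - z) w = det (z - y) w := by
          intro y z w
          simp [det]
          ring
        have hm : mir j ≠ 0 := Fin.succ_ne_zero _
        have hn : nxt j ≠ 0 := Fin.succ_ne_zero _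
        dsimp only at h1 h2
        rw [Function.update_of_ne hm] at h1 h2
        rw [Function.update_of_ne hn] at h2
        rw [hke]
        simp only [e1, e2, mul_left_comm _ k]
        refine ⟨mul_pos hk ?_, mul_pos hk h2⟩
        by_cases hp : pre j = 0
        · have h3 := hx1 j hp
          rw [hp] at h1 ⊢
          rw [Function.update_self] at h1
          have e3 : det (x (mir j) - x 0) (e (mir j)) =
              det (x (mir j) - (x 1 + x 0)) (e (mir j)) := by
            simp only [det, PiLp.sub_apply, PiLp.add_apply] at h3 ⊢
            linear_combination h3
          rw [e3]
          exact h1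
        · rwa [Function.update_of_ne hp] at h1
      · intro i hi
        rw [Function.update_of_ne hi]
        exact hx i
      · rw [Function.update_self, hx0, add_sub_cancel_right]
        exact hx 1
    have hmid : F.2 1 = -F.1 1 := by
      have := hF.2.2.2.2
      rw [midpoint_eq_smul_add, smul_eq_zero] at this
      have := this.resolve_left (by norm_num)
      exact (neg_eq_of_add_eq_zero_right this).symm
    have hpar : ∀ j : Fin N, pre j = 0 → det (F.1 1) (e (mir j)) = 0 := by
      intro j hp
      have hm1 : mir j = 1 := by
        have := congrArg Fin.val hp
        apply Fin.ext
        simp at this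
        simp [mir, this]
      obtain ⟨k, hk, hke⟩ := he j
      rw [hm1, hmid] at hke
      have h0 := congrArg (fun v : Plane => v 0) hke
      have h1 := congrArg (fun v : Plane => v 1) hke
      simp only [PiLp.sub_apply, PiLp.neg_apply, PiLp.smul_apply, smul_eq_mul] at h0 h1
      rw [hm1]
      simp only [det]
      linear_combination (e 1 1) * h0 / 2 - (e 1 0) * h1 / 2
    have k1 := key F.1 (fun i => left_mem_segment ℝ _ _) rfl hpar
    have k2 := key F.2 (fun i => right_mem_segment ℝ _ _) (hF.2.2.1.trans hF.2.1.symm) (by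
      intro j hp
      have := hpar j hp
      rw [hmid]
      simp only [det, PiLp.neg_apply] at this ⊢
      linear_combination -this)
    rw [reflexion_iff hF.1]
    exact fun j => ⟨orient χ j, (k1 j).1, (k2 j).1, (k1 j).2, (k2 j).2⟩

/-- The pair of chains on both sides of the chain `c`, in the directions `e`. -/
def pencil (c e : Chain N) (p q : Fin (N + 2) → ℝ) : Chain N × Chain N :=
  (fun i => c i + p i • e i, fun i => c i - q i • e i)

/-- Chains that are normalized as the centered chains of beams, with directions that vanish at
both ends. -/
def Normalized (N : ℕ) : Set (Chain N × Chain N) :=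
  {x | x.1 0 = !₂[-1, 0] ∧ x.1 1 = 0 ∧ x.2 0 = 0 ∧ x.2 (Fin.last (N + 1)) = 0}

lemma Adm.ne_zero {χ : Fin N → ℤˣ} {x : Chain N × Chain N} (h : x ∈ Adm χ) (j : Fin N) :
    x.2 (mir j) ≠ 0 := by
  intro h0
  have := (h.2 j).1
  rw [h0] at this
  simp [det] at this

section
variable {c e : Chain N} {p q : Fin (N + 2) → ℝ} {χ : Fin N → ℤˣ} {δ : ℝ}
  (hn : (c, e) ∈ Normalized N) (hp : ∀ i, 0 < p i) (hq : ∀ i, 0 < q i)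
  (hpδ : ∀ i, p i * ‖e i‖ < δ) (hqδ : ∀ i, q i * ‖e i‖ < δ)

include hn hp hq hpδ hqδ

/-- Each segment of the pencil lies in the δ-ball about its vertex. Vertex 0 is handled by the first
mirror, since it is displaced from `c 0` by a point of that mirror, which is centered near `c 1 =
0`. -/
lemma dist_lt_of_mem_pencil {d : Chain N}
    (hd : ∀ i, i ≠ 0 → d i ∈ segment ℝ ((pencil c e p q).1 i) ((pencil c e p q).2 i))
    (hd0 : d 0 - (pencil c e p q).1 0 ∈ segment ℝ ((pencil c e p q).1 1) ((pencil c e p q).2 1)) :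
    dist d c < δ := by
  have hs : ∀ i, segment ℝ ((pencil c e p q).1 i) ((pencil c e p q).2 i) ⊆
      Metric.ball (c i) δ := by
    intro i
    refine (convex_ball _ _).segment_subset ?_ ?_
    · simpa [pencil, dist_eq_norm, norm_smul, abs_of_pos (hp i)] using hpδ i
    · simpa [pencil, dist_eq_norm, norm_smul, abs_of_pos (hq i)] using hqδ i
  have hδ : 0 < δ := (mul_nonneg (hp 0).le (norm_nonneg _)).trans_lt (hpδ 0)
  rw [dist_pi_lt_iff hδ]
  intro i
  by_cases hi : i = 0
  · subst hi
    have h := hs 1 hd0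
    have he0 : e 0 = 0 := hn.2.2.1
    have e0 : (pencil c e p q).1 0 = c 0 := by simp [pencil, he0]
    have e1 : c 1 = 0 := hn.2.1
    rw [e0, e1] at h
    simpa [dist_eq_norm] using h
  · exact hs i (hd i hi)

variable (hδ : ∀ d, dist d c < δ → (d, e) ∈ Adm χ)

include hδ

lemma pencil_mem_Faisc (hpq : p 1 = q 1) : pencil c e p q ∈ Faisc N := by
  have hδ0 : 0 < δ := (mul_nonneg (hp 0).le (norm_nonneg _)).trans_lt (hpδ 0)
  have hA : (c, e) ∈ Adm χ := hδ c (by simpa using hδ0)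
  have hsub : ∀ i, (pencil c e p q).1 i - (pencil c e p q).2 i = (p i + q i) • e i := by
    intro i
    simp only [pencil, add_smul]
    abel
  have hpos : ∀ i, 0 < p i + q i := fun i => add_pos (hp i) (hq i)
  obtain ⟨n1, n2, n3, n4⟩ := hn
  simp only at n1 n2 n3 n4
  refine mem_Faisc_of_thin (e := e) (χ := χ) ⟨fun j => ?_, ?_, ?_, ?_, ?_⟩
    (fun j => ⟨_, hpos _, hsub _⟩)
    fun d hd hd0 => hδ d (dist_lt_of_mem_pencil ⟨n1, n2, n3, n4⟩ hp hq hpδ hqδ hd hd0)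
  · rw [← sub_ne_zero, hsub]
    exact smul_ne_zero (hpos _).ne' (Adm.ne_zero hA j)
  · simp [pencil, n3, n1]
  · simp [pencil, n3, n1]
  · simp [pencil, n4]
  · simp [pencil, n2, hpq, midpoint_eq_smul_add]

/-- The centered chain of a pencil need not be `c`, because propagation is not affine. Its vertices
lie on the mirrors, hence it is close to `c`. -/
lemma centeredChain_pencil_mem (h : pencil c e p q ∈ Faisc N) :
    dist (tChain (pencil c e p q) (1 / 2)) c < δ ∧ carF ⟨_, h⟩ = χ := by
  have hd : dist (tChain (pencil c e p q) (1 / 2)) c < δ := by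
    refine dist_lt_of_mem_pencil hn hp hq hpδ hqδ
      (fun i hi => tChain_mem_segment _ half_mem i hi) ?_
    rw [tChain_zero, add_sub_cancel_right, ← tChain_one]
    exact tChain_mem_segment _ half_mem 1 one_ne_zero
  refine ⟨hd, ?_⟩
  rw [carF_eq_iff]
  refine Adm.smul (hδ _ hd) fun j => ⟨p (mir j) + q (mir j), add_pos (hp _) (hq _), ?_⟩
  simp only [pencil, add_smul, Pi.sub_apply]
  abel

end

/-- Along a path of admissible chains, thin pencils are uniformly admissible. -/
lemma exists_uniform_thin {χ : Fin N → ℤˣ} {γ : unitInterval → Chain N × Chain N}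
    (hγ : Continuous γ) (h : ∀ s, γ s ∈ Adm χ) : ∃ δ : ℝ, ∃ ε : ℝ, 0 < ε ∧ ∀ s,
      (∀ d, dist d (γ s).1 < δ → (d, (γ s).2) ∈ Adm χ) ∧
      ∀ i x, 0 < x → x ≤ ε → x * ‖(γ s).2 i‖ < δ := by
  have hK := isCompact_range hγ
  -- The compact image of the path has a thickening inside the open set `Adm χ`; a norm bound on the
  -- directions then converts δ into a width.
  obtain ⟨δ, hδ, hsub⟩ := hK.exists_thickening_subset_open (isOpen_Adm χ)
    (Set.range_subset_iff.2 h)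
  obtain ⟨M, hM, hb⟩ := hK.isBounded.exists_pos_norm_le
  refine ⟨δ, δ / (M + 1), by positivity, fun s => ⟨fun d hd => hsub ?_, fun i x hx hxe => ?_⟩⟩
  · rw [Metric.mem_thickening_iff]
    refine ⟨γ s, Set.mem_range_self s, ?_⟩
    rw [Prod.dist_eq]
    simpa [hδ] using hd
  · have h1 : ‖(γ s).2 i‖ ≤ M :=
      (norm_le_pi_norm _ i).trans ((norm_snd_le _).trans (hb _ (Set.mem_range_self s)))
    calc x * ‖(γ s).2 i‖ ≤ δ / (M + 1) * M := by gcongr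
      _ < δ := by
        rw [div_mul_eq_mul_div, div_lt_iff₀ (by positivity)]
        nlinarith

/-- A beam is joined to thin pencils around its centered chain. -/
lemma exists_joined_pencil (hN : 1 ≤ N) {F : Chain N × Chain N} (hF : F ∈ Faisc N) {ε : ℝ}
    (hε : 0 < ε) : ∃ p q : Fin (N + 2) → ℝ, (∀ i, 0 < p i ∧ p i ≤ ε) ∧ (∀ i, 0 < q i ∧ q i ≤ ε) ∧
      p 1 = q 1 ∧ JoinedIn (Faisc N) F (pencil (tChain F (1 / 2)) (F.1 - F.2) p q) := by
  have hev : ∀ k : Fin (N + 1), ∃ r : ℝ, 0 < r ∧ ∀ t : ℝ, 0 ≤ t ∧ t ≤ 1 → |t - 1 / 2| < r →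
      (k : ℕ) < N → |impactParam F t k - impactParam F (1 / 2) k| < ε := by
    intro k
    by_cases hk : (k : ℕ) < N
    · have hc : Continuous fun t : unitInterval => impactParam F t k :=
        continuous_impactParam (F := fun _ => F) continuous_const continuous_subtype_val
          (fun _ => hF.1.1) (fun _ => hF.2.2) (fun x => x.2) k hk
      obtain ⟨r, hr, h⟩ := Metric.continuous_iff.1 hc ⟨1 / 2, half_mem⟩ ε hε
      refine ⟨r, hr, fun t ht htr _ => ?_⟩
      exact h ⟨t, ht⟩ htr
    · exact ⟨1, one_pos, fun _ _ _ h => absurd h hk⟩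
  choose r hr h using hev
  obtain ⟨ρ, hρ0, hρ⟩ : ∃ ρ : ℝ, 0 < ρ ∧ ∀ k, ρ ≤ r k := by
    refine ⟨Finset.univ.inf' Finset.univ_nonempty r, ?_, fun k =>
      Finset.inf'_le _ (Finset.mem_univ k)⟩
    rw [Finset.lt_inf'_iff]
    exact fun k _ => hr k
  let η : ℝ := min (ρ / 2) (1 / 2)
  have hη : 0 < η := by positivity
  have hη1 : η < ρ := (min_le_left _ _).trans_lt (by linarith)
  have hη2 : η ≤ 1 / 2 := min_le_right _ _
  have m1 : 0 ≤ 1 / 2 - η ∧ 1 / 2 - η ≤ 1 := ⟨by linarith, by linarith⟩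
  have m2 : 0 ≤ 1 / 2 + η ∧ 1 / 2 + η ≤ 1 := ⟨by linarith, by linarith⟩
  let p : Fin (N + 2) → ℝ := Fin.cons ε fun k =>
    if (k : ℕ) < N then impactParam F (1 / 2) k - impactParam F (1 / 2 - η) k else ε
  let q : Fin (N + 2) → ℝ := Fin.cons ε fun k =>
    if (k : ℕ) < N then impactParam F (1 / 2 + η) k - impactParam F (1 / 2) k else ε
  refine ⟨p, q, fun i => ?_, fun i => ?_, ?_, ?_⟩
  · induction i using Fin.cases with
    | zero => exact ⟨hε, le_rfl⟩
    | succ k =>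
      simp only [p, Fin.cons_succ]
      split_ifs with hk
      · have := h k _ m1 (by rw [abs_lt]; constructor <;> linarith [hρ k]) hk
        exact ⟨sub_pos.2 (impactParam_lt hF.1.1 hF.2.2 m1 half_mem (by linarith) k hk),
          by linarith [(abs_lt.1 this).1]⟩
      · exact ⟨hε, le_rfl⟩
  · induction i using Fin.cases with
    | zero => exact ⟨hε, le_rfl⟩
    | succ k =>
      simp only [q, Fin.cons_succ]
      split_ifs with hk
      · have := h k _ m2 (by rw [abs_lt]; constructor <;> linarith [hρ k]) hk
        exact ⟨sub_pos.2 (impactParam_lt hF.1.1 hF.2.2 half_mem m2 (by linarith) k hk),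
          by linarith [(abs_lt.1 this).2]⟩
      · exact ⟨hε, le_rfl⟩
  · have e1 : p 1 = if 0 < N then 1 / 2 - (1 / 2 - η) else ε := rfl
    have e2 : q 1 = if 0 < N then 1 / 2 + η - 1 / 2 else ε := rfl
    rw [e1, e2, if_pos (by omega), if_pos (by omega)]
    ring
  · have hj := joined_subBeam hF hη hη2
    have e0 : F.1 0 = F.2 0 := hF.1.2.1.trans hF.1.2.2.1.symm
    have el := hF.1.2.2.2.1
    have hmid : AffineMap.lineMap (F.1 1) (F.2 1) (1 / 2 : ℝ) = (0 : Plane) := by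
      rw [← hF.1.2.2.2.2, midpoint, invOf_eq_inv, one_div]
    convert hj using 1
    refine Prod.ext ?_ ?_ <;> ext1 i <;> induction i using Fin.cases with
    | zero =>
      simp only [pencil, tChain_zero, hmid, zero_add, Pi.sub_apply, e0, sub_self, smul_zero,
        add_zero, sub_zero]
      first | exact e0.symm | rfl
    | succ k =>
      first | rw [subBeam_fst_succ] | rw [subBeam_snd_succ]
      simp only [pencil, tChain_succ, Pi.sub_apply, p, q, Fin.cons_succ]
      by_cases hk : (k : ℕ) < N
      · rw [if_pos hk, Plane.ext_iff]
        simp only [lineMap_coord, PiLp.add_apply, PiLp.sub_apply, PiLp.smul_apply, smul_eq_mul]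
        constructor <;> ring
      · rw [eq_last_of_not_lt hk, ← el]
        simp

/-! ### A continuous choice of mirror directions -/

/-- The bisecting direction of the admissible orientations of a mirror `y` between `x` and `z`. -/
noncomputable def bisector (x y z : Plane) : Plane :=
  let w := ‖y - z‖ • (y - x) + ‖y - x‖ • (y - z)
  !₂[-w 1, w 0]

/-- With u = y - x and v = y - z, the first determinant is ‖u‖(‖u‖‖v‖ + ⟨u, v⟩), and symmetrically
for the second. Cauchy–Schwarz makes it nonnegative, with equality only if u and v are opposite,
that is, if y grazes the segment. -/
lemma det_bisector_pos {x y z : Plane} (h : y ∉ segment ℝ x z) :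
    0 < det (y - x) (bisector x y z) ∧ 0 < det (y - z) (bisector x y z) := by
  have hx : y - x ≠ 0 := by
    rw [sub_ne_zero]
    rintro rfl
    exact h (left_mem_segment ℝ _ _)
  have hz : y - z ≠ 0 := by
    rw [sub_ne_zero]
    rintro rfl
    exact h (right_mem_segment ℝ _ _)
  have hx' := norm_pos_iff.2 hx
  have hz' := norm_pos_iff.2 hz
  have hs : 0 < ‖y - x‖ * ‖y - z‖ + inner ℝ (y - x) (y - z) := by
    have h1 := real_inner_le_norm (y - x) (-(y - z))
    rw [inner_neg_right, norm_neg] at h1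
    refine lt_of_le_of_ne (by linarith) fun h0 => h ?_
    have h2 : inner ℝ (y - x) (-(y - z)) = ‖y - x‖ * ‖-(y - z)‖ := by
      rw [inner_neg_right, norm_neg]
      linarith
    rw [inner_eq_norm_mul_iff_real, norm_neg] at h2
    refine ⟨‖y - z‖ / (‖y - x‖ + ‖y - z‖), ‖y - x‖ / (‖y - x‖ + ‖y - z‖), by positivity,
      by positivity, by field_simp; ring, ?_⟩
    have hpos : ‖y - x‖ + ‖y - z‖ ≠ 0 := by positivity
    set a := ‖y - x‖
    set b := ‖y - z‖
    have h3 : b • x + a • z = (a + b) • y := by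
      have h4 : b • x + a • z - (a + b) • y = -(b • (y - x) - a • -(y - z)) := by module
      rw [← sub_eq_zero, h4, h2, sub_self, neg_zero]
    rw [div_eq_inv_mul, div_eq_inv_mul, mul_smul, mul_smul, ← smul_add, h3, smul_smul,
      inv_mul_cancel₀ hpos, one_smul]
  have hin : ∀ u v : Plane, inner ℝ u v = u 0 * v 0 + u 1 * v 1 := by
    intro u v
    simp [PiLp.inner_apply, Fin.sum_univ_two]
    ring
  have hd : ∀ u : Plane, det u (bisector x y z) =
      inner ℝ u (‖y - z‖ • (y - x) + ‖y - x‖ • (y - z)) := by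
    intro u
    rw [hin]
    simp [det, bisector]
    ring
  rw [hd, hd, inner_add_right, inner_add_right, inner_smul_right, inner_smul_right,
    inner_smul_right, inner_smul_right, real_inner_self_eq_norm_mul_norm,
    real_inner_self_eq_norm_mul_norm, real_inner_comm (y - x) (y - z)]
  constructor
  · calc 0 < _ := mul_pos hx' hs
      _ = _ := by ring
  · calc 0 < _ := mul_pos hz' hs
      _ = _ := by ring

lemma orient_mul_self (χ : Fin N → ℤˣ) (j : Fin N) : orient χ j * orient χ j = 1 := by
  unfold orient
  rw [mul_mul_mul_comm, ← pow_add, Even.neg_one_pow ⟨_, rfl⟩, mul_one]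
  rcases Int.units_eq_one_or (χ j) with h | h <;> rw [h] <;> simp

/-- A choice of mirror directions for given chain and characteristic. -/
noncomputable def directions (χ : Fin N → ℤˣ) (c : Chain N) : Chain N :=
  Fin.cons 0 (Fin.snoc (α := fun _ => Plane)
    (fun j : Fin N => orient χ j • bisector (c (pre j)) (c (mir j)) (c (nxt j))) 0)

lemma directions_mir (χ : Fin N → ℤˣ) (c : Chain N) (j : Fin N) :
    directions χ c (mir j) = orient χ j • bisector (c (pre j)) (c (mir j)) (c (nxt j)) := by
  rw [directions, mir, Fin.cons_succ, Fin.snoc_castSucc]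

lemma directions_zero (χ : Fin N → ℤˣ) (c : Chain N) : directions χ c 0 = 0 := rfl

lemma directions_last (χ : Fin N → ℤˣ) (c : Chain N) :
    directions χ c (Fin.last (N + 1)) = 0 := by
  rw [directions, ← Fin.succ_last, Fin.cons_succ, Fin.snoc_last]

lemma continuous_directions (χ : Fin N → ℤˣ) : Continuous (directions χ) := by
  refine continuous_pi fun i => ?_
  induction i using Fin.cases with
  | zero => exact continuous_const
  | succ k =>
    induction k using Fin.lastCases with
    | last =>
      simp only [Fin.succ_last, directions_last]
      exact continuous_const
    | cast j =>
      simp only [directions_mir]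
      have : Continuous fun c : Chain N => bisector (c (pre j)) (c (mir j)) (c (nxt j)) := by
        unfold bisector
        fun_prop
      exact this.const_smul (orient χ j)

lemma directions_mem_Adm (χ : Fin N → ℤˣ) {c : Chain N} (hc : c ∈ LO N) :
    (c, directions χ c) ∈ Adm χ := by
  refine ⟨hc, fun j => ?_⟩
  obtain ⟨h1, h2⟩ := det_bisector_pos ((mem_LO_iff.1 hc).2.2 j)
  have key : ∀ x y : Plane, orient χ j * det x (orient χ j • y) = det x y := by
    intro x y
    have : det x (orient χ j • y) = orient χ j * det x y := by
      simp [det]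
      ring
    rw [this, ← mul_assoc, orient_mul_self, one_mul]
  simp only [directions_mir, key]
  exact ⟨h1, h2⟩

/-- For a fixed chain the conditions on the directions are linear inequalities and equations, so the
straight segment stays admissible and normalized. -/
lemma joinedIn_directions {χ : Fin N → ℤˣ} {c e e' : Chain N}
    (h : (c, e) ∈ Adm χ ∩ Normalized N) (h' : (c, e') ∈ Adm χ ∩ Normalized N) :
    JoinedIn (Adm χ ∩ Normalized N) (c, e) (c, e') := by
  refine JoinedIn.ofLine (f := fun s : ℝ => (c, (1 - s) • e + s • e')) ?_ (by simp) (by simp) ?_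
  · fun_prop
  · rintro - ⟨s, ⟨hs0, hs1⟩, rfl⟩
    refine ⟨⟨h.1.1, fun j => ?_⟩, h.2.1, h.2.2.1, ?_, ?_⟩
    · have key : ∀ x y z : Plane, 0 < orient χ j * det x y → 0 < orient χ j * det x z →
          0 < orient χ j * det x ((1 - s) • y + s • z) := by
        intro x y z hy hz
        have h1 : SignType.sign _ = 1 :=
          sign_convex ⟨hs0, hs1⟩ one_ne_zero (sign_pos hy) (sign_pos hz)
        rw [sign_eq_one_iff] at h1
        calc 0 < _ := h1
          _ = _ := by simp [det]; ring
      exact ⟨key _ _ _ (h.1.2 j).1 (h'.1.2 j).1, key _ _ _ (h.1.2 j).2 (h'.1.2 j).2⟩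
    · have h1 : e 0 = 0 := h.2.2.2.1
      have h2 : e' 0 = 0 := h'.2.2.2.1
      simp [h1, h2]
    · have h1 : e (Fin.last (N + 1)) = 0 := h.2.2.2.2
      have h2 : e' (Fin.last (N + 1)) = 0 := h'.2.2.2.2
      simp [h1, h2]

/-! ### Normalization of chains by similarities -/

/-- The complex multiplication by `w` on the plane. -/
def rot (w : Plane) : Plane →ₗ[ℝ] Plane where
  toFun z := !₂[w 0 * z 0 - w 1 * z 1, w 0 * z 1 + w 1 * z 0]
  map_add' x y := by
    rw [Plane.ext_iff]
    simp
    constructor <;> ring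
  map_smul' r x := by
    rw [Plane.ext_iff]
    simp
    constructor <;> ring

lemma rot_apply (w z : Plane) :
    rot w z = !₂[w 0 * z 0 - w 1 * z 1, w 0 * z 1 + w 1 * z 0] := rfl

lemma normSq_pos {w : Plane} (hw : w ≠ 0) : 0 < w 0 ^ 2 + w 1 ^ 2 := by
  by_contra h
  apply hw
  rw [Plane.ext_iff]
  constructor
  · simp only [PiLp.zero_apply]; nlinarith [sq_nonneg (w 0), sq_nonneg (w 1)]
  · simp only [PiLp.zero_apply]; nlinarith [sq_nonneg (w 0), sq_nonneg (w 1)]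

lemma rot_injective {w : Plane} (hw : w ≠ 0) : Function.Injective (rot w) := by
  rw [← LinearMap.ker_eq_bot, LinearMap.ker_eq_bot']
  intro z hz
  have h := (normSq_pos hw).ne'
  rw [rot_apply, Plane.ext_iff] at hz
  simp at hz
  rw [Plane.ext_iff]
  constructor
  · apply mul_left_cancel₀ h
    simp only [PiLp.zero_apply]
    linear_combination (w 0) * hz.1 + (w 1) * hz.2
  · apply mul_left_cancel₀ h
    simp only [PiLp.zero_apply]
    linear_combination (w 0) * hz.2 - (w 1) * hz.1

/-- The image of a chain by the similarity `z ↦ w (z - x)`. -/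
def simil (w x : Plane) (c : Chain N) : Chain N := fun i => rot w (c i - x)

lemma simil_mem_LO {w : Plane} (hw : w ≠ 0) (x : Plane) {c : Chain N} (hc : c ∈ LO N) :
    simil w x c ∈ LO N := by
  let f : Plane →ᵃ[ℝ] Plane := (rot w).toAffineMap - AffineMap.const ℝ Plane (rot w x)
  have hf : ∀ z, f z = rot w (z - x) := fun z => (map_sub (rot w) z x).symm
  have hinj : Function.Injective f := by
    intro y z hyz
    rw [hf, hf] at hyz
    exact sub_left_injective (rot_injective hw hyz)
  have := map_mem_LO hinj hc
  simp only [hf] at this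
  exact this

lemma continuous_simil :
    Continuous fun y : Plane × Plane × Chain N => simil y.1 y.2.1 y.2.2 := by
  refine continuous_pi fun i => ?_
  simp only [simil, rot_apply]
  fun_prop

/-- The number `w` with `w (c_0 - c_1) = -1`. -/
noncomputable def normalizer (c : Chain N) : Plane :=
  (((c 0 - c 1) 0) ^ 2 + ((c 0 - c 1) 1) ^ 2)⁻¹ • !₂[-(c 0 - c 1) 0, (c 0 - c 1) 1]

lemma normalizer_ne_zero {c : Chain N} (hc : c ∈ LO N) : normalizer c ≠ 0 := by
  have h := sub_ne_zero.2 (mem_LO_iff.1 hc).1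
  have h2 := normSq_pos h
  refine smul_ne_zero (inv_ne_zero h2.ne') fun h0 => h ?_
  rw [Plane.ext_iff] at h0 ⊢
  simp only [PiLp.sub_apply] at h0 ⊢
  simp at h0 ⊢
  exact ⟨by linarith [h0.1], h0.2⟩

/-- The normalization of a chain, with `c_0 = (-1, 0)` and `c_1 = 0`. -/
noncomputable def normalize (c : Chain N) : Chain N := simil (normalizer c) (c 1) c

lemma normalize_mem_LO {c : Chain N} (hc : c ∈ LO N) : normalize c ∈ LO N :=
  simil_mem_LO (normalizer_ne_zero hc) _ hc

lemma normalize_one (c : Chain N) : normalize c 1 = 0 := by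
  simp [normalize, simil]

lemma normalize_zero {c : Chain N} (hc : c ∈ LO N) : normalize c 0 = !₂[-1, 0] := by
  have h2 := (normSq_pos (sub_ne_zero.2 (mem_LO_iff.1 hc).1)).ne'
  rw [normalize, simil, rot_apply, normalizer]
  set d := c 0 - c 1
  rw [Plane.ext_iff]
  simp
  constructor <;> field_simp <;> ring

lemma normalize_eq_self {c : Chain N} (h0 : c 0 = !₂[-1, 0]) (h1 : c 1 = 0) :
    normalize c = c := by
  ext1 i
  rw [normalize, simil, rot_apply, normalizer, h0, h1, Plane.ext_iff]
  simp

lemma continuous_normalize : Continuous fun c : LO N => normalize c.1 := by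
  have c0 : ∀ i, Continuous fun c : LO N => c.1 i :=
    fun i => (continuous_apply i).comp continuous_subtype_val
  have hd := (c0 0).sub (c0 1)
  refine continuous_simil.comp (Continuous.prodMk ?_ ((c0 1).prodMk continuous_subtype_val))
  have h1 : Continuous fun d : Plane => d 0 ^ 2 + d 1 ^ 2 := by fun_prop
  have h2 : Continuous fun d : Plane => !₂[-d 0, d 1] := by fun_prop
  exact ((h1.comp hd).inv₀ fun c =>
    (normSq_pos (sub_ne_zero.2 (mem_LO_iff.1 c.2).1)).ne').smul (h2.comp hd)

/-- A chain is joined to its normalization. -/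
lemma joinedIn_normalize {c : Chain N} (hc : c ∈ LO N) : JoinedIn (LO N) c (normalize c) := by
  -- The parameters of the similarities form the product of the punctured plane and the plane, which
  -- is path connected; their action on c stays in `LO N`.
  have h1 : IsPathConnected ({0}ᶜ : Set Plane) :=
    isPathConnected_compl_singleton_of_one_lt_rank (by
      rw [← Module.finrank_eq_rank]
      simp) 0
  have h2 : IsPathConnected (({0}ᶜ : Set Plane) ×ˢ (Set.univ : Set Plane)) :=
    h1.prod isPathConnected_univ
  have h3 : IsPathConnected ((fun y : Plane × Plane => simil y.1 y.2 c) ''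
      (({0}ᶜ : Set Plane) ×ˢ (Set.univ : Set Plane))) := by
    refine h2.image ?_
    exact continuous_simil.comp (continuous_fst.prodMk (continuous_snd.prodMk continuous_const))
  refine (h3.joinedIn c ?_ (normalize c) ?_).mono ?_
  · refine ⟨(!₂[1, 0], 0), ⟨?_, trivial⟩, ?_⟩
    · intro h
      have := congrArg (fun v : Plane => v 0) h
      simp at this
    · ext1 i
      rw [Plane.ext_iff]
      simp [simil, rot_apply]
  · exact ⟨(normalizer c, c 1), ⟨normalizer_ne_zero hc, trivial⟩, rfl⟩
  · rintro - ⟨⟨w, x⟩, ⟨hw, -⟩, rfl⟩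
    exact simil_mem_LO hw x hc

/-! ### Paths of normalized pairs and the invariants of beams -/

lemma joined_of_nomenclature_eq {c c' : LO N} (h : nomenclature c = nomenclature c') :
    Joined c c' := by
  have : LocallyPathConnectedSpace (LO N) := isOpen_LO.locallyPathConnectedSpace
  rw [nomenclature, nomenclature, ConnectedComponents.coe_eq_coe] at h
  rw [← mem_pathComponent_iff, pathComponent_eq_connectedComponent, h]
  exact mem_connectedComponent

lemma nomenclature_eq_of_joinedIn {c c' : LO N} (h : JoinedIn (LO N) c.1 c'.1) :
    nomenclature c = nomenclature c' := by
  have h1 : Joined c c' := (joinedIn_iff_joined c.2 c'.2).1 h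
  rw [nomenclature, nomenclature, ConnectedComponents.coe_eq_coe, connectedComponent_eq_iff_mem]
  exact pathComponent_subset_component _ h1.symm

/-- Normalized admissible data with equal invariants are joined. -/
lemma joinedIn_Adm {χ : Fin N → ℤˣ} {c c' : LO N} {e e' : Chain N}
    (h : nomenclature c = nomenclature c') (he : (c.1, e) ∈ Adm χ ∩ Normalized N)
    (he' : (c'.1, e') ∈ Adm χ ∩ Normalized N) :
    JoinedIn (Adm χ ∩ Normalized N) (c.1, e) (c'.1, e') := by
  have hd : ∀ d : LO N, d.1 0 = !₂[-1, 0] → d.1 1 = 0 →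
      (d.1, directions χ d.1) ∈ Adm χ ∩ Normalized N := fun d h0 h1 =>
    ⟨directions_mem_Adm χ d.2, h0, h1, directions_zero χ d.1, directions_last χ d.1⟩
  have h1 := hd c he.2.1 he.2.2.1
  have h2 := hd c' he'.2.1 he'.2.2.1
  refine (joinedIn_directions he h1).trans (JoinedIn.trans ?_ (joinedIn_directions h2 he'))
  -- A path in `LO N` need not be normalized, but normalizing each of its chains is continuous and
  -- fixes the two ends.
  obtain ⟨γ⟩ := joined_of_nomenclature_eq h
  refine ⟨⟨⟨fun s => (normalize (γ s).1, directions χ (normalize (γ s).1)), ?_⟩, ?_, ?_⟩,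
    fun s => ?_⟩
  · have := continuous_normalize.comp γ.continuous
    exact this.prodMk ((continuous_directions χ).comp this)
  · simp only [Path.source]
    rw [normalize_eq_self he.2.1 he.2.2.1]
  · simp only [Path.target]
    rw [normalize_eq_self he'.2.1 he'.2.2.1]
  · exact hd ⟨_, normalize_mem_LO (γ s).2⟩ (normalize_zero (γ s).2) (normalize_one (γ s).1)

lemma continuous_centeredChain : Continuous (centeredChain (N := N)) :=
  (continuous_tChain continuous_subtype_val continuous_const (fun F : Faisc N => F.2.1)
    (fun F => F.2.2.2) fun _ => half_mem).subtype_mk _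

/-- The target is discrete, and each fibre is the preimage of an open set `Adm χ`. -/
lemma continuous_carF : Continuous (carF (N := N)) := by
  refine continuous_discrete_rng.2 fun χ => ?_
  have h : carF ⁻¹' {χ} = (fun F : Faisc N => (tChain F.1 (1 / 2), F.1.1 - F.1.2)) ⁻¹' Adm χ := by
    ext F
    exact carF_eq_iff F χ
  rw [h]
  refine (isOpen_Adm χ).preimage (Continuous.prodMk ?_ ?_)
  · exact continuous_subtype_val.comp continuous_centeredChain
  · exact continuous_subtype_val.fst.sub continuous_subtype_val.snd

lemma continuous_invariantF : Continuous (invariantF (N := N)) :=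
  (ConnectedComponents.continuous_coe.comp continuous_centeredChain).prodMk continuous_carF

lemma mem_Adm_inter_Normalized (F : Faisc N) :
    (tChain F.1 (1 / 2), F.1.1 - F.1.2) ∈ Adm (carF F) ∩ Normalized N := by
  have hmid : AffineMap.lineMap (F.1.1 1) (F.1.2 1) (1 / 2 : ℝ) = (0 : Plane) := by
    rw [← F.2.1.2.2.2.2, midpoint, invOf_eq_inv, one_div]
  refine ⟨(carF_eq_iff F _).1 rfl, ?_, hmid, ?_, ?_⟩
  · dsimp only
    rw [tChain_zero, hmid, zero_add, F.2.1.2.1]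
  · exact sub_eq_zero.2 (F.2.1.2.1.trans F.2.1.2.2.1.symm)
  · exact sub_eq_zero.2 F.2.1.2.2.2.1

/-- Beams with the same invariants are joined. -/
lemma joined_of_invariant_eq (hN : 1 ≤ N) {F F' : Faisc N}
    (hn : nomenclatureF F = nomenclatureF F') (hc : carF F = carF F') : Joined F F' := by
  have h1 := mem_Adm_inter_Normalized F
  have h2 := mem_Adm_inter_Normalized F'
  rw [← hc] at h2
  obtain ⟨γ, hγ⟩ := joinedIn_Adm (c := centeredChain F) (c' := centeredChain F') hn h1 h2
  -- The width ε is fixed for the whole path before the two beams are squeezed, so that both pencils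
  -- at the ends fit it.
  obtain ⟨δ, ε, hε, h⟩ := exists_uniform_thin γ.continuous fun s => (hγ s).1
  obtain ⟨p, q, hp, hq, hpq, hj⟩ := exists_joined_pencil hN F.2 hε
  obtain ⟨p', q', hp', hq', hpq', hj'⟩ := exists_joined_pencil hN F'.2 hε
  rw [← joinedIn_iff_joined F.2 F'.2]
  refine hj.trans (JoinedIn.trans ?_ hj'.symm)
  have conv : ∀ (s : unitInterval) (x y : ℝ), 0 < x ∧ x ≤ ε → 0 < y ∧ y ≤ ε →
      0 < (1 - (s : ℝ)) * x + s * y ∧ (1 - (s : ℝ)) * x + s * y ≤ ε := by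
    intro s x y hx hy
    exact (convex_Ioc 0 ε) hx hy (sub_nonneg.2 s.2.2) s.2.1 (by ring)
  have hP := fun s i => conv s _ _ (hp i) (hp' i)
  have hQ := fun s i => conv s _ _ (hq i) (hq' i)
  -- The half-widths are interpolated linearly: they stay in (0, ε] and remain equal on both sides
  -- of the first mirror.
  refine ⟨⟨⟨fun s => pencil (γ s).1 (γ s).2 (fun i => (1 - (s : ℝ)) * p i + s * p' i)
    (fun i => (1 - (s : ℝ)) * q i + s * q' i), ?_⟩, ?_, ?_⟩, fun s => ?_⟩
  · have c1 : ∀ i, Continuous fun s => (γ s).1 i :=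
      fun i => (continuous_apply i).comp γ.continuous.fst
    have c2 : ∀ i, Continuous fun s => (γ s).2 i :=
      fun i => (continuous_apply i).comp γ.continuous.snd
    have c3 : ∀ x y : ℝ, Continuous fun s : unitInterval => (1 - (s : ℝ)) * x + s * y := by
      intro x y
      fun_prop
    exact (continuous_pi fun i => (c1 i).add ((c3 _ _).smul (c2 i))).prodMk
      (continuous_pi fun i => (c1 i).sub ((c3 _ _).smul (c2 i)))
  · have : γ 0 = (tChain F.1 (1 / 2), F.1.1 - F.1.2) := γ.source
    simp [this]
  · have : γ 1 = (tChain F'.1 (1 / 2), F'.1.1 - F'.1.2) := γ.target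
    simp [this]
  · exact pencil_mem_Faisc (hγ s).2 (fun i => (hP s i).1) (fun i => (hQ s i).1)
      (fun i => (h s).2 i _ (hP s i).1 (hP s i).2) (fun i => (h s).2 i _ (hQ s i).1 (hQ s i).2)
      (h s).1 (by rw [hpq, hpq'])

/-- Every pair of invariants is realized by a beam. -/
lemma surjective_invariantF : Function.Surjective (invariantF (N := N)) := by
  rintro ⟨C, χ⟩
  obtain ⟨c, rfl⟩ := ConnectedComponents.surjective_coe C
  let c₁ : LO N := ⟨normalize c.1, normalize_mem_LO c.2⟩
  have hA := directions_mem_Adm χ c₁.2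
  have hn : (c₁.1, directions χ c₁.1) ∈ Normalized N :=
    ⟨normalize_zero c.2, normalize_one c.1, directions_zero χ c₁.1, directions_last χ c₁.1⟩
  obtain ⟨δ, ε, hε, h⟩ := exists_uniform_thin (χ := χ)
    (γ := fun _ => (c₁.1, directions χ c₁.1)) continuous_const fun _ => hA
  obtain ⟨hδ, hε'⟩ := h 0
  have hp : ∀ i : Fin (N + 2), ε * ‖directions χ c₁.1 i‖ < δ := fun i => hε' i ε hε le_rfl
  have hF := pencil_mem_Faisc (p := fun _ => ε) (q := fun _ => ε) hn (fun _ => hε) (fun _ => hε)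
    hp hp hδ rfl
  obtain ⟨hd, hcar⟩ := centeredChain_pencil_mem hn (fun _ => hε) (fun _ => hε) hp hp hδ hF
  refine ⟨⟨_, hF⟩, Prod.ext ?_ hcar⟩
  have hδ0 : 0 < δ := dist_nonneg.trans_lt hd
  -- The centered chain obtained may differ from `c₁`, but both lie in a ball contained in `LO N`.
  have hball : JoinedIn (LO N) (tChain (pencil c₁.1 (directions χ c₁.1) (fun _ => ε) fun _ => ε)
      (1 / 2)) c₁.1 := by
    have hb := ((convex_ball c₁.1 δ).isPathConnected ⟨_, Metric.mem_ball_self hδ0⟩).joinedIn _ hd _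
      (Metric.mem_ball_self hδ0)
    exact hb.mono fun d hd => (hδ d hd).1
  exact nomenclature_eq_of_joinedIn (c' := c) (hball.trans (joinedIn_normalize c.2).symm)

/-- The invariant is continuous with values in a totally disconnected space, so it factors through
the components. -/
lemma invariantF_eq_of_connectedComponent_eq {F F' : Faisc N}
    (h : connectedComponent F = connectedComponent F') : invariantF F = invariantF F' := by
  have hc := continuous_invariantF (N := N)
  rw [← hc.connectedComponentsLift_apply_coe, ← hc.connectedComponentsLift_apply_coe,
    ConnectedComponents.coe_eq_coe.2 h]

end OpticalBeam

theorem mainTheorem2 (N : ℕ) (hN : 1 ≤ N) :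
    (∀ F F' : OpticalBeam.Faisc N,
      OpticalBeam.nomenclatureF F = OpticalBeam.nomenclatureF F' →
      OpticalBeam.carF F = OpticalBeam.carF F' → Joined F F') ∧
    (∀ F F' : OpticalBeam.Faisc N, Joined F F' ↔ connectedComponent F = connectedComponent F') ∧
    ∃ e : ConnectedComponents (OpticalBeam.Faisc N) ≃
        ConnectedComponents (OpticalBeam.LO N) × (Fin N → ℤˣ),
      ∀ F : OpticalBeam.Faisc N, e (ConnectedComponents.mk F) = OpticalBeam.invariantF F := by
  have h1 : ∀ F F' : OpticalBeam.Faisc N, Joined F F' →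
      connectedComponent F = connectedComponent F' :=
    fun F F' h => connectedComponent_eq_iff_mem.2 (pathComponent_subset_component _ h.symm)
  have h2 : ∀ F F' : OpticalBeam.Faisc N,
      OpticalBeam.invariantF F = OpticalBeam.invariantF F' → Joined F F' := fun F F' h =>
    OpticalBeam.joined_of_invariant_eq hN (congrArg Prod.fst h) (congrArg Prod.snd h)
  have hc := OpticalBeam.continuous_invariantF (N := N)
  -- Components yield paths through the invariants: beams in one component have equal invariants,
  -- hence are joined. No local path connectedness of the space of beams is needed.
  refine ⟨fun F F' => OpticalBeam.joined_of_invariant_eq hN, fun F F' => ⟨h1 F F',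
    fun h => h2 F F' (OpticalBeam.invariantF_eq_of_connectedComponent_eq h)⟩, Equiv.ofBijective
    hc.connectedComponentsLift ⟨?_, ?_⟩, fun F => hc.connectedComponentsLift_apply_coe F⟩
  · intro x y hxy
    obtain ⟨F, rfl⟩ := ConnectedComponents.surjective_coe x
    obtain ⟨F', rfl⟩ := ConnectedComponents.surjective_coe y
    rw [hc.connectedComponentsLift_apply_coe, hc.connectedComponentsLift_apply_coe] at hxy
    exact ConnectedComponents.coe_eq_coe.2 (h1 F F' (h2 F F' hxy))
  · intro y
    obtain ⟨F, rfl⟩ := OpticalBeam.surjective_invariantF y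
    exact ⟨F, hc.connectedComponentsLift_apply_coe F⟩
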